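/- **The scheme.** Let $\gamma_0=0$, $\gamma_6=1$, and let $\gamma_1,\dots,\gamma_5$ be real splitting ratios. For the system $M\ddot U+C\dot U+KU=F(t)$ in $\mathbb R^d$ ($M$ invertible) one step of size $h>0$ from data $(U_n,\dot U_n)$ at time $t_n$ is defined by the equations, for $i=0,\dots,6$, $$M\ddot U_{n+\gamma_i}+C\dot U_{n+\gamma_i}+KU_{n+\gamma_i}=F(t_n+\gamma_i h),\quad U_{n+\gamma_i}=U_n+h\sum_{j=0}^{i}\alpha_{ij}\dot U_{n+\gamma_j},\quad \dot U_{n+\gamma_i}=\dot U_n+h\sum_{j=0}^{i}\alpha_{ij}\ddot U_{n+\gamma_j},$$ and its result is $(U_{n+1},\dot U_{n+1},\ddot U_{n+1})$, the stage $i=6$. Here $\alpha_{00}=0$, $\alpha_{10}=\frac{\gamma_1}{2}$, $\alpha_{ii}=\frac{\gamma_1}2$ $(1\le i\le 6)$, and $$\alpha_{20}=\frac{-\gamma_1^2+3\gamma_1\gamma_2-\gamma_2^2}{2\gamma_1},\qquad \alpha_{21}=\frac{\gamma_2(\gamma_2-\gamma_1)}{2\gamma_1},$$ $$\alpha_{i0}=\frac{-\gamma_1^2+\big(3\gamma_i-2\sum_{j=2}^{i-1}\alpha_{ij}\big)\gamma_1+2\sum_{j=2}^{i-1}\alpha_{ij}\gamma_j-\gamma_i^2}{2\gamma_1},\qquad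 \alpha_{i1}=\frac{-2\sum_{j=2}^{i-1}\alpha_{ij}\gamma_j-\gamma_1\gamma_i+\gamma_i^2}{2\gamma_1}\qquad(3\le i\le 6),$$ $$\alpha_{65}=\frac{\left\{\begin{aligned}&30(1-\gamma_4)(\gamma_3-1)(\gamma_2-1)\gamma_1^2+(45-50\gamma_4+10\gamma_3(6\gamma_4-5))\gamma_1\gamma_2+3\gamma_3(5\gamma_4-4)\\&+(45\gamma_4-42+5\gamma_3(9-10\gamma_4))\gamma_1+(15\gamma_4-12+5\gamma_3(3-4\gamma_4))\gamma_2-12\gamma_4+10\end{aligned}\right\}}{60\gamma_5(\gamma_4-\gamma_5)(\gamma_3-\gamma_5)(\gamma_2-\gamma_5)(\gamma_1-\gamma_5)},$$ $$\alpha_{64}=\frac{\left\{\begin{aligned}&30(1-\gamma_3)(\gamma_2-1)\gamma_1^2+[45-50\gamma_3+10\gamma_2(6\gamma_3-5)-60\alpha_{65}\gamma_5(\gamma_3-\gamma_5)(\gamma_2-\gamma_5)]\gamma_1\\&+[15-20\gamma_3+60\alpha_{65}\gamma_5^2(\gamma_3-\gamma_5)]\gamma_2-60\alpha_{65}\gamma_5^3(\gamma_3-\gamma_5)+15\gamma_3-12\end{aligned}\right\}}{60\gamma_4(\gamma_3-\gamma_4)(\gamma_2-\gamma_4)(\gamma_1-\gamma_4)},$$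 $$\alpha_{54}=\frac{\left\{\begin{aligned}&15(\gamma_3-1)(\gamma_2-1)\gamma_1^3+[35\gamma_3-30+5\gamma_2(7-9\gamma_3)]\gamma_1^2+[15-20\gamma_3+10\gamma_2(3\gamma_3-2)]\gamma_1\\&+(3-5\gamma_3)\gamma_2+3\gamma_3-2\end{aligned}\right\}}{60\alpha_{65}\gamma_4(\gamma_3-\gamma_4)(\gamma_2-\gamma_4)(\gamma_1-\gamma_4)},$$ $$\alpha_{63}=\frac{12\alpha_{64}\gamma_4(\gamma_2-\gamma_4)(\gamma_4-\gamma_1)+12\alpha_{65}\gamma_5(\gamma_2-\gamma_5)(\gamma_5-\gamma_1)-6\gamma_1(\gamma_1(\gamma_2-1)-2\gamma_2)-10\gamma_1-4\gamma_2+3}{12\gamma_3(\gamma_2-\gamma_3)(\gamma_1-\gamma_3)},$$ $$\alpha_{53}=\frac{\left\{\begin{aligned}&240\alpha_{65}^2\alpha_{54}^2\gamma_4(\gamma_2-\gamma_4)(\gamma_4-\gamma_1)+30\alpha_{64}\gamma_1^4(\gamma_2-1)+[60\alpha_{65}\alpha_{54}(\gamma_2-1)+30\alpha_{64}(3-4\gamma_2)]\gamma_1^3\\&+[20\alpha_{65}\alpha_{54}(7-9\gamma_2)+15\alpha_{64}(8\gamma_2-5)]\gamma_1^2+[40\alpha_{65}\alpha_{54}(3\gamma_2-2)+2\alpha_{64}(11-20\gamma_2)]\gamma_1\\&+4\alpha_{65}\alpha_{54}(3-5\gamma_2)+2\alpha_{64}(2\gamma_2-1)\end{aligned}\right\}}{240\alpha_{65}^2\alpha_{54}\gamma_3(\gamma_2-\gamma_3)(\gamma_1-\gamma_3)},$$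 $$\alpha_{43}=\frac{\left\{\begin{aligned}&60\alpha_{65}\alpha_{53}\gamma_3(\gamma_2-\gamma_3)(\gamma_3-\gamma_1)+60\alpha_{65}\alpha_{54}\gamma_4(\gamma_2-\gamma_4)(\gamma_4-\gamma_1)\\&+5\gamma_1^2(3\gamma_1\gamma_2-3\gamma_1-9\gamma_2+7)+30\gamma_1\gamma_2-20\gamma_1-5\gamma_2+3\end{aligned}\right\}}{60\alpha_{64}\gamma_3(\gamma_2-\gamma_3)(\gamma_1-\gamma_3)},$$ $$\alpha_{62}=\frac{6\alpha_{63}\gamma_3(\gamma_1-\gamma_3)+6\alpha_{64}\gamma_4(\gamma_1-\gamma_4)+6\alpha_{65}\gamma_5(\gamma_1-\gamma_5)+3\gamma_1^2-6\gamma_1+2}{6\gamma_2(\gamma_2-\gamma_1)},$$ $$\alpha_{52}=\frac{\left\{\begin{aligned}&45(\alpha_{64}^2\alpha_{43}+\alpha_{65}\alpha_{64}\alpha_{53}-\alpha_{65}\alpha_{63}\alpha_{54})\gamma_1^5-12\alpha_{65}\alpha_{54}\alpha_{43}(5\alpha_{65}\alpha_{54}-\alpha_{64})+2\alpha_{65}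(\alpha_{63}\alpha_{54}-\alpha_{64}\alpha_{53})\\&+(90\alpha_{65}\alpha_{64}\alpha_{54}\alpha_{43}-225\alpha_{64}^2\alpha_{43}-225\alpha_{65}\alpha_{64}\alpha_{53}+225\alpha_{65}\alpha_{63}\alpha_{54})\gamma_1^4+720\alpha_{65}^3\alpha_{54}^2\alpha_{43}(\alpha_{54}\gamma_4^2+\alpha_{53}\gamma_3^2)\\&+[180\alpha_{65}\alpha_{54}\alpha_{43}(\alpha_{65}\alpha_{54}-2\alpha_{64})+300(\alpha_{64}^2\alpha_{43}+\alpha_{65}\alpha_{64}\alpha_{53}-\alpha_{65}\alpha_{63}\alpha_{54})]\gamma_1^3-2\alpha_{43}\alpha_{64}^2\\&+[180\alpha_{65}\alpha_{54}\alpha_{43}(2\alpha_{64}-3\alpha_{65}\alpha_{54})-150(\alpha_{64}^2\alpha_{43}+\alpha_{65}\alpha_{64}\alpha_{53}-\alpha_{65}\alpha_{63}\alpha_{54})]\gamma_1^2\\&+[360\alpha_{65}^2\alpha_{54}^2\alpha_{43}(1-2\alpha_{65}(\alpha_{54}\gamma_4+\alpha_{53}\gamma_3))-30\alpha_{64}\alpha_{43}(4\alpha_{65}\alpha_{54}-\alpha_{64})+30\alpha_{65}(\alpha_{64}\alpha_{53}-\alpha_{63}\alpha_{54})]\gamma_1\end{aligned}\right\}}{720\alpha_{65}^3\alpha_{54}^2\alpha_{43}\gamma_2(\gamma_1-\gamma_2)},$$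 $$\alpha_{42}=\frac{\left\{\begin{aligned}&-45(\alpha_{64}\alpha_{43}+\alpha_{65}\alpha_{53})\gamma_1^5+(225\alpha_{64}\alpha_{43}+225\alpha_{65}\alpha_{53}-90\alpha_{65}\alpha_{54}\alpha_{43})\gamma_1^4+720\alpha_{65}^2\alpha_{54}^2\alpha_{43}^2\gamma_3^2\\&+(360\alpha_{65}\alpha_{54}\alpha_{43}-300\alpha_{64}\alpha_{43}-300\alpha_{65}\alpha_{53})\gamma_1^3+(150\alpha_{64}\alpha_{43}+150\alpha_{65}\alpha_{53}-360\alpha_{65}\alpha_{54}\alpha_{43})\gamma_1^2\\&+(120\alpha_{65}\alpha_{54}\alpha_{43}-30\alpha_{64}\alpha_{43}-30\alpha_{65}\alpha_{53}-720\alpha_{65}^2\alpha_{54}^2\alpha_{43}^2\gamma_3)\gamma_1-12\alpha_{65}\alpha_{54}\alpha_{43}+2\alpha_{64}\alpha_{43}+2\alpha_{65}\alpha_{53}\end{aligned}\right\}}{720\alpha_{65}^2\alpha_{54}^2\alpha_{43}\gamma_2(\gamma_1-\gamma_2)},$$ $$\alpha_{32}=\frac{45\gamma_1^5-225\gamma_1^4+300\gamma_1^3-150\gamma_1^2+30\gamma_1-2}{720\alpha_{65}\alpha_{54}\alpha_{43}\gamma_2(\gamma_1-\gamma_2)}.$$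 Call $\gamma=(\gamma_0,\dots,\gamma_6)$ *admissible* if no denominator vanishes: $0,\gamma_1,\dots,\gamma_5$ are pairwise distinct and $\alpha_{65},\alpha_{64},\alpha_{54},\alpha_{43}$ are nonzero. **Single degree of freedom.** For $\ddot u+2\xi\omega\dot u+\omega^2u=f(t)$ put $A=(\alpha_{ij})_{0\le i,j\le 6}$ (lower triangular, row $0$ zero), $b^{T}=(\alpha_{60},\dots,\alpha_{66})$, $S=\begin{bmatrix}2\xi\omega I+\omega^2hA& I\\ I&-hA\end{bmatrix}$ and $B=\begin{bmatrix}hb^{T}&0\\0&hb^{T}\end{bmatrix}$; the numerical amplification matrix and, for $f=\exp$ and $t_n=0$, the numerical load operator are $$D_{num}=I_2+BS^{-1}\begin{bmatrix}-\omega^2\mathbf 1&0\\0&\mathbf 1\end{bmatrix},\qquad L_{num}=BS^{-1}\begin{bmatrix}(e^{\gamma_ih})_{0\le i\le 6}\\0\end{bmatrix},$$ and $D_{exa}$, $L_{exa}$ are their exact counterparts: $(u(h),\dot u(h))^{T}=D_{exa}(u(0),\dot u(0))^{T}+L_{exa}$ for every exact solution with $f=\exp$. **Theorem.** Let $\gamma$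 be admissible. 1. (Sixth order.) For all $d$, all real $d\times d$ matrices $M,C,K$ with $M$ invertible, every $F\in C^6(\mathbb R,\mathbb R^d)$, every exact solution $U$ of $M\ddot U+C\dot U+KU=F$ on $\mathbb R$ and every $t_n$: for all sufficiently small $h>0$ the step from $(U(t_n),\dot U(t_n))$ has exactly one solution, and as $h\to0^+$ $$U_{n+1}-U(t_n+h)=O(h^7),\quad \dot U_{n+1}-\dot U(t_n+h)=O(h^7),\quad \ddot U_{n+1}-\ddot U(t_n+h)=O(h^7).$$ Moreover, for $0\le\xi<1$ and $\omega>0$, $D_{num}-D_{exa}=O(h^7)$ and $L_{num}-L_{exa}=O(h^7)$ as $h\to0^+$. 2. (High-frequency limit.) For every real $\xi$ and every $h>0$, $S$ is invertible for all large $\omega$, and as $\omega\to\infty$ the characteristic polynomial $\det(\zeta I_2-D_{num})$ converges coefficientwise to $(\zeta-r(\gamma_1))^2$, where $$r(\gamma_1)=\frac{45\gamma_1^6-540\gamma_1^5+1350\gamma_1^4-1200\gamma_1^3+450\gamma_1^2-72\gamma_1+4}{45\gamma_1^6}.$$ 3. (Dissipation control.) For every $\rho_\infty\in[0,1]$ there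 is $\gamma_1\in(0,1)$ with $r(\gamma_1)=\rho_\infty$ such that the default ratios $\gamma_i=i\gamma_1$ $(1\le i\le5)$ are admissible; hence for these ratios the limit polynomial in part 2 is $(\zeta-\rho_\infty)^2$. -/

import Mathlib

open Matrix Filter Topology Asymptotics

/-! The composite `s`-sub-step implicit scheme. The splitting ratios are `γ 0, …, γ s`
(with `γ 0 = 0`, `γ s = 1`), the coefficients `α i j` form the lower-triangular matrix `A`. -/

namespace SubStep

noncomputable section

/-- `Us`, `Vs`, `As` are displacements, velocities and accelerations at the instants
`t + γ i * h`, `i = 0, …, s`, produced by one step of size `h` of the scheme for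
`M U'' + C U' + K U = F(t)`, started at time `t` from displacement `u` and velocity `v`.
The row `A 0` is zero, so that `Us 0 = u`, `Vs 0 = v`, and `As 0` is the acceleration given by
the equation of motion at time `t`. The output at time `t + h` is the last stage. -/
def IsStep {s d : ℕ} (A : Matrix (Fin (s + 1)) (Fin (s + 1)) ℝ) (γ : Fin (s + 1) → ℝ)
    (M C K : Matrix (Fin d) (Fin d) ℝ) (F : ℝ → Fin d → ℝ) (t h : ℝ) (u v : Fin d → ℝ)
    (Us Vs As : Fin (s + 1) → Fin d → ℝ) : Prop :=
  ∀ i, M *ᵥ As i + C *ᵥ Vs i + K *ᵥ Us i = F (t + γ i * h) ∧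
    Us i = u + h • ∑ j, A i j • Vs j ∧
    Vs i = v + h • ∑ j, A i j • As j

/-- Accuracy of order `p` in displacement, velocity and acceleration for all linear systems
`M U'' + C U' + K U = F(t)`: for all small steps the scheme started on an exact solution has
exactly one numerical solution, and its errors after one step are `O(h ^ (p + 1))`. -/
def HasOrder {s : ℕ} (A : Matrix (Fin (s + 1)) (Fin (s + 1)) ℝ) (γ : Fin (s + 1) → ℝ)
    (p : ℕ) : Prop :=
  ∀ (d : ℕ) (M C K : Matrix (Fin d) (Fin d) ℝ), IsUnit M →
  ∀ F : ℝ → Fin d → ℝ, ContDiff ℝ p F →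
  ∀ U V W : ℝ → Fin d → ℝ,
    (∀ t, HasDerivAt U (V t) t) → (∀ t, HasDerivAt V (W t) t) →
    (∀ t, M *ᵥ W t + C *ᵥ V t + K *ᵥ U t = F t) →
  ∀ t : ℝ, ∃ Us Vs As : ℝ → Fin (s + 1) → Fin d → ℝ,
    (∀ᶠ h in 𝓝[>] (0 : ℝ),
      IsStep A γ M C K F t h (U t) (V t) (Us h) (Vs h) (As h) ∧
      ∀ Us' Vs' As', IsStep A γ M C K F t h (U t) (V t) Us' Vs' As' →
        Us' = Us h ∧ Vs' = Vs h ∧ As' = As h) ∧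
    (fun h => Us h (Fin.last s) - U (t + h)) =O[𝓝[>] 0] (fun h : ℝ => h ^ (p + 1)) ∧
    (fun h => Vs h (Fin.last s) - V (t + h)) =O[𝓝[>] 0] (fun h : ℝ => h ^ (p + 1)) ∧
    (fun h => As h (Fin.last s) - W (t + h)) =O[𝓝[>] 0] (fun h : ℝ => h ^ (p + 1))

/-! Single degree of freedom `u'' + 2 ξ ω u' + ω² u = f(t)`. -/

/-- The matrix of the linear system for the stage velocities and accelerations. -/
def stageMatrix {s : ℕ} (A : Matrix (Fin (s + 1)) (Fin (s + 1)) ℝ) (ξ ω h : ℝ) :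
    Matrix (Fin (s + 1) ⊕ Fin (s + 1)) (Fin (s + 1) ⊕ Fin (s + 1)) ℝ :=
  Matrix.fromBlocks ((2 * ξ * ω) • 1 + (ω ^ 2 * h) • A) 1 1 (-(h • A))

/-- The update matrix with rows `(h bᵀ, 0)` and `(0, h bᵀ)`, where `bᵀ` is the last row of
`A`. -/
def updateMatrix {s : ℕ} (A : Matrix (Fin (s + 1)) (Fin (s + 1)) ℝ) (h : ℝ) :
    Matrix (Fin 2) (Fin (s + 1) ⊕ Fin (s + 1)) ℝ :=
  Matrix.of ![Sum.elim (fun j => h * A (Fin.last s) j) (fun _ => 0),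
    Sum.elim (fun _ => 0) (fun j => h * A (Fin.last s) j)]

/-- The matrix with rows `(-ω², 0)` (first block) and `(0, 1)` (second block). -/
def inputMatrix (s : ℕ) (ω : ℝ) : Matrix (Fin (s + 1) ⊕ Fin (s + 1)) (Fin 2) ℝ :=
  Matrix.of (Sum.elim (fun _ => ![-ω ^ 2, 0]) (fun _ => ![0, 1]))

/-- The numerical amplification matrix. -/
def Dnum {s : ℕ} (A : Matrix (Fin (s + 1)) (Fin (s + 1)) ℝ) (ξ ω h : ℝ) :
    Matrix (Fin 2) (Fin 2) ℝ :=
  1 + updateMatrix A h * (stageMatrix A ξ ω h)⁻¹ * inputMatrix s ω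

/-- The numerical load operator for the load `f(t) = exp t` and a step started at time `0`. -/
def Lnum {s : ℕ} (A : Matrix (Fin (s + 1)) (Fin (s + 1)) ℝ) (γ : Fin (s + 1) → ℝ)
    (ξ ω h : ℝ) : Fin 2 → ℝ :=
  (updateMatrix A h * (stageMatrix A ξ ω h)⁻¹) *ᵥ
    Sum.elim (fun i => Real.exp (γ i * h)) (fun _ => 0)

/-- The damped frequency. -/
def dampedFreq (ξ ω : ℝ) : ℝ := Real.sqrt (1 - ξ ^ 2) * ω

/-- The exact amplification matrix (underdamped case). -/
def Dexa (ξ ω h : ℝ) : Matrix (Fin 2) (Fin 2) ℝ :=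
  let w := dampedFreq ξ ω
  Real.exp (-ξ * ω * h) •
    !![Real.cos (w * h) + ξ * ω / w * Real.sin (w * h), 1 / w * Real.sin (w * h);
      -(ω ^ 2 / w) * Real.sin (w * h), -(ξ * ω / w) * Real.sin (w * h) + Real.cos (w * h)]

/-- The exact load operator (underdamped case) for the load `f(t) = exp t` from time `0`. -/
def Lexa (ξ ω h : ℝ) : Fin 2 → ℝ :=
  let w := dampedFreq ξ ω
  ![Real.exp h / (ω ^ 2 + 2 * ξ * ω + 1) - Real.exp (-ξ * ω * h) *
      ((w * Real.cos (w * h) + (1 + ξ * ω) * Real.sin (w * h)) /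
        (w * (ω ^ 2 + 2 * ξ * ω + 1))),
    Real.exp h / (ω ^ 2 + 2 * ξ * ω + 1) + Real.exp (-ξ * ω * h) *
      (((ω ^ 2 + ξ * ω) * Real.sin (w * h) - w * Real.cos (w * h)) /
        (w * (ω ^ 2 + 2 * ξ * ω + 1)))]

/-- As `ω → ∞`, the characteristic polynomial of `D ω` converges (coefficient by coefficient)
to `(X - r)²`, that is, `D` has the double eigenvalue `r` in the high-frequency limit. -/
def HasDoubleEigenvalueAtInfinity (D : ℝ → Matrix (Fin 2) (Fin 2) ℝ) (r : ℝ) : Prop :=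
  ∀ k : ℕ, Tendsto (fun ω => (D ω).charpoly.coeff k) atTop
    (𝓝 (((Polynomial.X - Polynomial.C r) ^ 2).coeff k))

end

end SubStep

/-! The coefficients of the six-sub-step scheme as functions of the splitting ratios
`γ 1, …, γ 5`. -/

namespace SUCI6

noncomputable section

def a65 (γ : Fin 7 → ℝ) : ℝ :=
    (30 * (1 - γ 4) * (γ 3 - 1) * (γ 2 - 1) * γ 1^2 + (45 - 50 * γ 4 + 10 * γ 3 * (6 * γ 4 -
    5)) * γ 1 * γ 2 + 3 * γ 3 * (5 * γ 4 - 4) + (45 * γ 4 - 42 + 5 * γ 3 * (9 -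
    10 * γ 4)) * γ 1 + (15 * γ 4 - 12 + 5 * γ 3 * (3 - 4 * γ 4)) * γ 2 - 12 * γ 4 + 10) /
    (60 * γ 5 * (γ 4 - γ 5) * (γ 3 - γ 5) * (γ 2 - γ 5) * (γ 1 - γ 5))

def a64 (γ : Fin 7 → ℝ) : ℝ :=
    (30 * (1 - γ 3) * (γ 2 - 1) * γ 1^2 + (45 - 50 * γ 3 + 10 * γ 2 * (6 * γ 3 - 5) -
    60 * a65 γ * γ 5 * (γ 3 - γ 5) * (γ 2 - γ 5)) * γ 1 + (15 - 20 * γ 3 +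
    60 * a65 γ * γ 5^2 * (γ 3 - γ 5)) * γ 2 - 60 * a65 γ * γ 5^3 * (γ 3 - γ 5) + 15 * γ 3 -
    12) / (60 * γ 4 * (γ 3 - γ 4) * (γ 2 - γ 4) * (γ 1 - γ 4))

def a54 (γ : Fin 7 → ℝ) : ℝ :=
    (15 * (γ 3 - 1) * (γ 2 - 1) * γ 1^3 + (35 * γ 3 - 30 + 5 * γ 2 * (7 - 9 * γ 3)) * γ 1^2 +
    (15 - 20 * γ 3 + 10 * γ 2 * (3 * γ 3 - 2)) * γ 1 + (3 - 5 * γ 3) * γ 2 + 3 * γ 3 - 2) /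
    (60 * a65 γ * γ 4 * (γ 3 - γ 4) * (γ 2 - γ 4) * (γ 1 - γ 4))

def a63 (γ : Fin 7 → ℝ) : ℝ :=
    (12 * a64 γ * γ 4 * (γ 2 - γ 4) * (γ 4 - γ 1) + 12 * a65 γ * γ 5 * (γ 2 - γ 5) * (γ 5 -
    γ 1) - 6 * γ 1 * (γ 1 * (γ 2 - 1) - 2 * γ 2) - 10 * γ 1 - 4 * γ 2 + 3) /
    (12 * γ 3 * (γ 2 - γ 3) * (γ 1 - γ 3))

def a53 (γ : Fin 7 → ℝ) : ℝ :=
    (240 * a65 γ^2 * a54 γ^2 * γ 4 * (γ 2 - γ 4) * (γ 4 - γ 1) + 30 * a64 γ * γ 1^4 * (γ 2 -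
    1) + (60 * a65 γ * a54 γ * (γ 2 - 1) + 30 * a64 γ * (3 - 4 * γ 2)) * γ 1^3 +
    (20 * a65 γ * a54 γ * (7 - 9 * γ 2) + 15 * a64 γ * (8 * γ 2 - 5)) * γ 1^2 +
    (40 * a65 γ * a54 γ * (3 * γ 2 - 2) + 2 * a64 γ * (11 - 20 * γ 2)) * γ 1 +
    4 * a65 γ * a54 γ * (3 - 5 * γ 2) + 2 * a64 γ * (2 * γ 2 - 1)) /
    (240 * a65 γ^2 * a54 γ * γ 3 * (γ 2 - γ 3) * (γ 1 - γ 3))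

def a43 (γ : Fin 7 → ℝ) : ℝ :=
    (60 * a65 γ * a53 γ * γ 3 * (γ 2 - γ 3) * (γ 3 - γ 1) + 60 * a65 γ * a54 γ * γ 4 * (γ 2 -
    γ 4) * (γ 4 - γ 1) + 5 * γ 1^2 * (3 * γ 1 * γ 2 - 3 * γ 1 - 9 * γ 2 + 7) +
    30 * γ 1 * γ 2 - 20 * γ 1 - 5 * γ 2 + 3) / (60 * a64 γ * γ 3 * (γ 2 - γ 3) * (γ 1 - γ 3))

def a62 (γ : Fin 7 → ℝ) : ℝ :=
    (6 * a63 γ * γ 3 * (γ 1 - γ 3) + 6 * a64 γ * γ 4 * (γ 1 - γ 4) + 6 * a65 γ * γ 5 * (γ 1 -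
    γ 5) + 3 * γ 1^2 - 6 * γ 1 + 2) / (6 * γ 2 * (γ 2 - γ 1))

def a52 (γ : Fin 7 → ℝ) : ℝ :=
    (45 * (a64 γ^2 * a43 γ + a65 γ * a64 γ * a53 γ - a65 γ * a63 γ * a54 γ) * γ 1^5 -
    12 * a65 γ * a54 γ * a43 γ * (5 * a65 γ * a54 γ - a64 γ) + 2 * a65 γ * (a63 γ * a54 γ -
    a64 γ * a53 γ) +
    (90 * a65 γ * a64 γ * a54 γ * a43 γ - 225 * a64 γ^2 * a43 γ -
    225 * a65 γ * a64 γ * a53 γ + 225 * a65 γ * a63 γ * a54 γ) * γ 1^4 +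
    720 * a65 γ^3 * a54 γ^2 * a43 γ * (a54 γ * γ 4^2 + a53 γ * γ 3^2) +
    (180 * a65 γ * a54 γ * a43 γ * (a65 γ * a54 γ - 2 * a64 γ) + 300 * (a64 γ^2 * a43 γ +
    a65 γ * a64 γ * a53 γ - a65 γ * a63 γ * a54 γ)) * γ 1^3 - 2 * a43 γ * a64 γ^2 +
    (180 * a65 γ * a54 γ * a43 γ * (2 * a64 γ - 3 * a65 γ * a54 γ) -
    150 * (a64 γ^2 * a43 γ + a65 γ * a64 γ * a53 γ - a65 γ * a63 γ * a54 γ)) * γ 1^2 +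
    (360 * a65 γ^2 * a54 γ^2 * a43 γ * (1 - 2 * a65 γ * (a54 γ * γ 4 + a53 γ * γ 3)) -
    30 * a64 γ * a43 γ * (4 * a65 γ * a54 γ - a64 γ) + 30 * a65 γ * (a64 γ * a53 γ -
    a63 γ * a54 γ)) * γ 1) / (720 * a65 γ^3 * a54 γ^2 * a43 γ * γ 2 * (γ 1 - γ 2))

def a42 (γ : Fin 7 → ℝ) : ℝ :=
    (-45 * (a64 γ * a43 γ + a65 γ * a53 γ) * γ 1^5 + (225 * a64 γ * a43 γ +
    225 * a65 γ * a53 γ - 90 * a65 γ * a54 γ * a43 γ) * γ 1^4 +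
    720 * a65 γ^2 * a54 γ^2 * a43 γ^2 * γ 3^2 +
    (360 * a65 γ * a54 γ * a43 γ - 300 * a64 γ * a43 γ - 300 * a65 γ * a53 γ) * γ 1^3 +
    (150 * a64 γ * a43 γ + 150 * a65 γ * a53 γ - 360 * a65 γ * a54 γ * a43 γ) * γ 1^2 +
    (120 * a65 γ * a54 γ * a43 γ - 30 * a64 γ * a43 γ - 30 * a65 γ * a53 γ -
    720 * a65 γ^2 * a54 γ^2 * a43 γ^2 * γ 3) * γ 1 - 12 * a65 γ * a54 γ * a43 γ +
    2 * a64 γ * a43 γ + 2 * a65 γ * a53 γ) / (720 * a65 γ^2 * a54 γ^2 * a43 γ * γ 2 * (γ 1 -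
    γ 2))

def a32 (γ : Fin 7 → ℝ) : ℝ :=
    (45 * γ 1^5 - 225 * γ 1^4 + 300 * γ 1^3 - 150 * γ 1^2 + 30 * γ 1 - 2) /
    (720 * a65 γ * a54 γ * a43 γ * γ 2 * (γ 1 - γ 2))

def a61 (γ : Fin 7 → ℝ) : ℝ :=
    (-2 * a62 γ * γ 2 - 2 * a63 γ * γ 3 - 2 * a64 γ * γ 4 - 2 * a65 γ * γ 5 - γ 1 + 1) /
    (2 * γ 1)

def a60 (γ : Fin 7 → ℝ) : ℝ :=
    (-γ 1^2 + (3 - 2 * a62 γ - 2 * a63 γ - 2 * a64 γ - 2 * a65 γ) * γ 1 + 2 * a62 γ * γ 2 +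
    2 * a63 γ * γ 3 + 2 * a64 γ * γ 4 + 2 * a65 γ * γ 5 - 1) / (2 * γ 1)

def a51 (γ : Fin 7 → ℝ) : ℝ :=
    (-2 * a52 γ * γ 2 - 2 * a53 γ * γ 3 - 2 * a54 γ * γ 4 - γ 1 * γ 5 + γ 5^2) / (2 * γ 1)

def a50 (γ : Fin 7 → ℝ) : ℝ :=
    (-γ 1^2 + (3 * γ 5 - 2 * a52 γ - 2 * a53 γ - 2 * a54 γ) * γ 1 + 2 * a52 γ * γ 2 +
    2 * a53 γ * γ 3 + 2 * a54 γ * γ 4 - γ 5^2) / (2 * γ 1)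

def a41 (γ : Fin 7 → ℝ) : ℝ :=
    (-2 * a42 γ * γ 2 - 2 * a43 γ * γ 3 - γ 1 * γ 4 + γ 4^2) / (2 * γ 1)

def a40 (γ : Fin 7 → ℝ) : ℝ :=
    (-γ 1^2 + (3 * γ 4 - 2 * a42 γ - 2 * a43 γ) * γ 1 + 2 * a42 γ * γ 2 + 2 * a43 γ * γ 3 -
    γ 4^2) / (2 * γ 1)

def a31 (γ : Fin 7 → ℝ) : ℝ :=
    (-2 * a32 γ * γ 2 - γ 1 * γ 3 + γ 3^2) / (2 * γ 1)

def a30 (γ : Fin 7 → ℝ) : ℝ :=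
    (-γ 1^2 + (3 * γ 3 - 2 * a32 γ) * γ 1 + 2 * a32 γ * γ 2 - γ 3^2) / (2 * γ 1)

def a21 (γ : Fin 7 → ℝ) : ℝ :=
    γ 2 * (γ 2 - γ 1) / (2 * γ 1)

def a20 (γ : Fin 7 → ℝ) : ℝ :=
    (-γ 1^2 + 3 * γ 1 * γ 2 - γ 2^2) / (2 * γ 1)

/-- The coefficient matrix, with the trapezoidal rule in the first sub-step and all
`α i i = γ 1 / 2`. -/
def coeffs (γ : Fin 7 → ℝ) : Matrix (Fin 7) (Fin 7) ℝ :=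
  !![0, 0, 0, 0, 0, 0, 0;
    γ 1 / 2, γ 1 / 2, 0, 0, 0, 0, 0;
    a20 γ, a21 γ, γ 1 / 2, 0, 0, 0, 0;
    a30 γ, a31 γ, a32 γ, γ 1 / 2, 0, 0, 0;
    a40 γ, a41 γ, a42 γ, a43 γ, γ 1 / 2, 0, 0;
    a50 γ, a51 γ, a52 γ, a53 γ, a54 γ, γ 1 / 2, 0;
    a60 γ, a61 γ, a62 γ, a63 γ, a64 γ, a65 γ, γ 1 / 2]

/-- The splitting ratios for which the coefficients are defined: `γ 0 = 0`, `γ 6 = 1`, and no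
denominator in the formulas for the coefficients vanishes. -/
structure Admissible (γ : Fin 7 → ℝ) : Prop where
  zero : γ 0 = 0
  one : γ 6 = 1
  distinct : ∀ i j : Fin 7, i ≠ 6 → j ≠ 6 → i ≠ j → γ i ≠ γ j
  h65 : a65 γ ≠ 0
  h64 : a64 γ ≠ 0
  h54 : a54 γ ≠ 0
  h43 : a43 γ ≠ 0

/-- The high-frequency eigenvalue as a function of `γ 1`. -/
def rhoInf (g : ℝ) : ℝ :=
  (45 * g ^ 6 - 540 * g ^ 5 + 1350 * g ^ 4 - 1200 * g ^ 3 + 450 * g ^ 2 - 72 * g + 4) /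
    (45 * g ^ 6)

/-- The default splitting ratios `γ i = i * γ 1` for `i ≤ 5`. -/
def defaultRatios (g : ℝ) : Fin 7 → ℝ := ![0, g, 2 * g, 3 * g, 4 * g, 5 * g, 1]

end

end SUCI6

/-! Order. Since `M` is invertible, the scheme is a Runge–Kutta method for a linear system y' = Ly +
g(t). With T = A ⊗ L, the stage error E satisfies E - hTE = δ, where δ is the defect of the exact
solution, and hence E = ∑_{m ≤ p} h^m T^m δ + h^(p+1) T^(p+1) E with E bounded. The Taylor expansion
of δ consists of tensors d_k ⊗ y^(k+1)(t) times h^(k+1), so the last stage only sees the numbers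
(A^m d_k)_s. These vanish for m + k < p as soon as (A^(m+1) γ^l)_s = l!/(m+l+1)! for m + l < p
(`LinearOrderConditions`, `last_stage_isBigO`, `hasOrder_of_linearOrderConditions`). The estimates
for `Dnum` and `Lnum` are the case d = 1 for particular exact solutions. For the given coefficients,
A1 = γ and Aγ = γ²/2 leave ten conditions, as many as there are coefficients α_ij with 2 ≤ j < i. In
the Newton basis γ(γ-γ₁)⋯(γ-γ_k) they can be solved one after another, and the formulas for the
coefficients are these solutions (the `moment_…` lemmas, `linearOrderConditions_coeffs`).

High frequency. With the velocity divided by ω, the stages solve Y = 1 ⊗ x + hω (A ⊗ J)Y with J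
invertible and independent of ω. If Aw = 0 and w₀ = 1, then Y tends to w ⊗ x at rate 1/(hω)
(`exists_stiff_bound`), so the limiting double eigenvalue is the last entry of w. As A is lower
triangular with diagonal 0, μ, …, μ, where μ = γ₁/2, Cayley–Hamilton gives w = μ⁻⁶(A-μ)⁶1, and the
order conditions evaluate its last entry to `rhoInf` (`exists_kernel_vector`).

Dissipation control. On [1/3, 7/20] the function `rhoInf` takes the value 1 at the left end and a
negative value at the right end, while the default ratios stay admissible (`exists_rhoInf_eq`,
`admissible_defaultRatios`). -/

namespace SubStep

noncomputable section

/-! ### Tensor operators on stage values. -/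

section StageMap

variable {ι X : Type*} [Fintype ι] [NormedAddCommGroup X] [NormedSpace ℝ X]

/-- The operator `A ⊗ L` on tuples of stage values. -/
def stageMap (A : Matrix ι ι ℝ) (L : X →L[ℝ] X) : (ι → X) →L[ℝ] (ι → X) :=
  ContinuousLinearMap.pi fun i => ∑ j, A i j • L.comp (ContinuousLinearMap.proj j)

theorem stageMap_apply (A : Matrix ι ι ℝ) (L : X →L[ℝ] X) (Y : ι → X) (i : ι) :
    stageMap A L Y i = ∑ j, A i j • L (Y j) := by
  simp [stageMap]

theorem stageMap_mul (A B : Matrix ι ι ℝ) (L L' : X →L[ℝ] X) :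
    stageMap A L * stageMap B L' = stageMap (A * B) (L * L') := by
  ext Y i
  simp only [mul_apply_eq_comp, stageMap_apply, map_sum, map_smul,
    Finset.smul_sum, smul_smul, Matrix.mul_apply, Finset.sum_smul]
  exact Finset.sum_comm

theorem stageMap_one [DecidableEq ι] : stageMap (1 : Matrix ι ι ℝ) (1 : X →L[ℝ] X) = 1 := by
  ext Y i
  simp [stageMap_apply, Matrix.one_apply]

theorem stageMap_tensor (A : Matrix ι ι ℝ) (L : X →L[ℝ] X) (x : ι → ℝ) (v : X) :
    stageMap A L (fun i => x i • v) = fun i => (A *ᵥ x) i • L v := by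
  ext i
  simp [stageMap_apply, Matrix.mulVec, dotProduct, Finset.sum_smul, smul_smul]

/-- On pure tensors x ⊗ v the two factors act separately; this reduces vector-valued order
conditions to scalar ones on A. -/
theorem stageMap_pow_tensor [DecidableEq ι] (A : Matrix ι ι ℝ) (L : X →L[ℝ] X) (m : ℕ)
    (x : ι → ℝ) (v : X) :
    (stageMap A L ^ m) (fun i => x i • v) = fun i => (A ^ m *ᵥ x) i • (L ^ m) v := by
  induction m with
  | zero => simp
  | succ m ih =>
    rw [pow_succ', mul_apply_eq_comp, ih, stageMap_tensor, Matrix.mulVec_mulVec,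
      ← pow_succ', pow_succ' L, mul_apply_eq_comp]

end StageMap

/-! ### Order conditions and the expansion of the stage defect. -/

section Order

variable {X : Type*} [NormedAddCommGroup X] [NormedSpace ℝ X]

/-- Only n derivatives are available, so the Peano remainder o(h^n) is used and the term of degree n
is moved into the O(h^n). -/
theorem taylor_sum_isBigO {f : ℝ → X} {n : ℕ} (hf : ContDiff ℝ n f) (t : ℝ) :
    (fun h => f (t + h) - ∑ k ∈ Finset.range n, (h ^ k / k.factorial) • iteratedDeriv k f t)
      =O[𝓝 0] fun h : ℝ => h ^ n := by
  have h1 := (taylor_isLittleO_univ (x₀ := t) hf).isBigO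
  have h2 : Tendsto (fun h : ℝ => t + h) (𝓝 0) (𝓝 t) := by
    have : Continuous fun h : ℝ => t + h := by fun_prop
    simpa using this.tendsto 0
  have h3 := h1.comp_tendsto h2
  have h4 : (fun h : ℝ => (h ^ n / n.factorial) • iteratedDeriv n f t) =O[𝓝 0]
      fun h : ℝ => h ^ n := by
    refine IsBigO.of_bound (‖iteratedDeriv n f t‖ / n.factorial) (Eventually.of_forall fun h => ?_)
    rw [norm_smul, norm_div, Real.norm_natCast]
    exact le_of_eq (by ring)
  have h5 := IsBigO.add (h3.congr_right (g₂ := fun h : ℝ => h ^ n) (by intro h; simp)) h4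
  refine h5.congr_left fun h => ?_
  simp only [Function.comp_apply, taylor_within_apply, iteratedDerivWithin_univ]
  rw [Finset.sum_range_succ]
  have e : ∀ k : ℕ, ((k.factorial : ℝ)⁻¹ * (t + h - t) ^ k) = h ^ k / k.factorial := by
    intro k; rw [add_sub_cancel_left, div_eq_inv_mul]
  simp only [e]
  abel

theorem taylor_sum_isBigO_mul {f : ℝ → X} {n : ℕ} (hf : ContDiff ℝ n f) (t c : ℝ) :
    (fun h => f (t + c * h) -
        ∑ k ∈ Finset.range n, ((c * h) ^ k / k.factorial) • iteratedDeriv k f t)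
      =O[𝓝 0] fun h : ℝ => h ^ n := by
  have h1 : Tendsto (fun h : ℝ => c * h) (𝓝 0) (𝓝 0) := by
    have : Continuous fun h : ℝ => c * h := by fun_prop
    simpa using this.tendsto 0
  refine ((taylor_sum_isBigO hf t).comp_tendsto h1).trans ?_
  refine IsBigO.of_bound (‖c‖ ^ n) (Eventually.of_forall fun h => le_of_eq ?_)
  simp [mul_pow]

/-- The conditions for order `p` of a Runge--Kutta scheme applied to linear systems
`y' = L y + g(t)`. -/
def LinearOrderConditions {s : ℕ} (A : Matrix (Fin (s + 1)) (Fin (s + 1)) ℝ)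
    (γ : Fin (s + 1) → ℝ) (p : ℕ) : Prop :=
  ∀ m l : ℕ, m + l < p →
    (A ^ (m + 1) *ᵥ fun i => γ i ^ l) (Fin.last s) = l.factorial / (m + l + 1).factorial

variable {s : ℕ} {A : Matrix (Fin (s + 1)) (Fin (s + 1)) ℝ} {γ : Fin (s + 1) → ℝ} {p : ℕ}

/-- The defect of the exact solution at the stages. -/
def stageDefect (A : Matrix (Fin (s + 1)) (Fin (s + 1)) ℝ) (γ : Fin (s + 1) → ℝ)
    (y y' : ℝ → X) (t h : ℝ) (i : Fin (s + 1)) : X :=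
  y t + h • ∑ j, A i j • y' (t + γ j * h) - y (t + γ i * h)

/-- The coefficients of the expansion of the defect in powers of the step size. -/
def defectCoeff (A : Matrix (Fin (s + 1)) (Fin (s + 1)) ℝ) (γ : Fin (s + 1) → ℝ) (k : ℕ) :
    Fin (s + 1) → ℝ :=
  (1 / k.factorial : ℝ) • (A *ᵥ fun i => γ i ^ k) -
    (1 / (k + 1).factorial : ℝ) • fun i => γ i ^ (k + 1)

/-- Both parts of the defect coefficient contribute 1/(m+k+1)!. For m > 0 these are the order
conditions at (m, k) and (m-1, k+1); for m = 0 the second one is replaced by γ_s = 1. -/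
theorem pow_mulVec_defectCoeff_last (hA : LinearOrderConditions A γ p)
    (hγ : γ (Fin.last s) = 1) {m k : ℕ} (hmk : m + k < p) :
    (A ^ m *ᵥ defectCoeff A γ k) (Fin.last s) = 0 := by
  have h1 := hA m k hmk
  rw [defectCoeff, Matrix.mulVec_sub, Matrix.mulVec_smul, Matrix.mulVec_smul,
    Matrix.mulVec_mulVec, ← pow_succ, Pi.sub_apply, Pi.smul_apply, Pi.smul_apply, h1]
  have hk : (k.factorial : ℝ) ≠ 0 := by exact_mod_cast k.factorial_ne_zero
  have hk1 : ((k + 1).factorial : ℝ) ≠ 0 := by exact_mod_cast (k + 1).factorial_ne_zero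
  have hk2 : ((m + k + 1).factorial : ℝ) ≠ 0 := by
    exact_mod_cast (m + k + 1).factorial_ne_zero
  rcases m with _ | m
  · simp only [pow_zero, Matrix.one_mulVec, hγ, one_pow, smul_eq_mul]
    rw [zero_add]
    field_simp
    ring
  · have h2 := hA m (k + 1) (by omega)
    rw [h2, show m + (k + 1) + 1 = m + 1 + k + 1 by ring]
    simp only [smul_eq_mul]
    field_simp
    ring

theorem stageDefect_isBigO {y : ℝ → X} (hy : ContDiff ℝ ((p + 1 : ℕ)) y) (t : ℝ) :
    (fun h => stageDefect A γ y (deriv y) t h -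
      ∑ k ∈ Finset.range p, h ^ (k + 1) •
        fun i => defectCoeff A γ k i • iteratedDeriv (k + 1) y t)
      =O[𝓝 0] fun h : ℝ => h ^ (p + 1) := by
  have hy' : ContDiff ℝ p (deriv y) := by
    have : ContDiff ℝ ((p : WithTop ℕ∞) + 1) y := by exact_mod_cast hy
    exact (contDiff_succ_iff_deriv.1 this).2.2
  refine isBigO_pi.2 fun i => ?_
  have h1 := taylor_sum_isBigO_mul hy t (γ i)
  have h2 : ∀ j, (fun h : ℝ => h • (A i j • (deriv y (t + γ j * h) -
      ∑ k ∈ Finset.range p, ((γ j * h) ^ k / k.factorial) • iteratedDeriv k (deriv y) t)))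
      =O[𝓝 0] fun h : ℝ => h ^ (p + 1) := by
    intro j
    have := (isBigO_refl (fun h : ℝ => h) (𝓝 0)).smul
      ((taylor_sum_isBigO_mul hy' t (γ j)).const_smul_left (A i j))
    refine this.congr_right fun h => ?_
    rw [smul_eq_mul, pow_succ']
  have h3 := (IsBigO.sum (s := Finset.univ) fun j _ => h2 j).sub h1
  refine h3.congr_left fun h => ?_
  simp only [stageDefect, defectCoeff, Pi.sub_apply, Finset.sum_apply, Pi.smul_apply,
    ← iteratedDeriv_succ']
  rw [Finset.sum_range_succ']
  simp only [pow_zero, Nat.factorial_zero, Nat.cast_one, div_one, one_smul, iteratedDeriv_zero,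
    smul_sub, Finset.sum_sub_distrib, Finset.smul_sum]
  have e : ∑ j, ∑ k ∈ Finset.range p, h • A i j • ((γ j * h) ^ k / (k.factorial : ℝ)) •
        iteratedDeriv (k + 1) y t -
      ∑ k ∈ Finset.range p, ((γ i * h) ^ (k + 1) / ((k + 1).factorial : ℝ)) •
        iteratedDeriv (k + 1) y t =
      ∑ k ∈ Finset.range p, h ^ (k + 1) • ((1 / (k.factorial : ℝ)) •
        (A *ᵥ fun i => γ i ^ k) i - (1 / ((k + 1).factorial : ℝ)) • γ i ^ (k + 1)) •
        iteratedDeriv (k + 1) y t := by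
    rw [Finset.sum_comm, ← Finset.sum_sub_distrib]
    refine Finset.sum_congr rfl fun k _ => ?_
    simp only [smul_smul]
    rw [← Finset.sum_smul, ← sub_smul]
    congr 1
    simp only [Matrix.mulVec, dotProduct, smul_eq_mul, mul_sub, Finset.mul_sum]
    congr 1
    · exact Finset.sum_congr rfl fun j _ => by ring
    · ring
  rw [← e]
  abel

end Order

/-! ### From order conditions to the error of the last stage. -/

section Order

theorem pow_isBigO_pow_of_le {m n : ℕ} (h : n ≤ m) :
    (fun x : ℝ => x ^ m) =O[𝓝[>] 0] fun x : ℝ => x ^ n := by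
  obtain ⟨k, rfl⟩ := Nat.exists_eq_add_of_le h
  have h1 : (fun x : ℝ => x ^ k) =O[𝓝[>] 0] fun _ : ℝ => (1 : ℝ) := by
    have : Tendsto (fun x : ℝ => x ^ k) (𝓝[>] 0) (𝓝 (0 ^ k)) :=
      ((continuous_pow k).tendsto 0).mono_left nhdsWithin_le_nhds
    exact this.isBigO_one ℝ
  simpa [pow_add] using (isBigO_refl (fun x : ℝ => x ^ n) (𝓝[>] 0)).mul h1

theorem pow_isBigO_one (m : ℕ) : (fun x : ℝ => x ^ m) =O[𝓝[>] 0] fun _ : ℝ => (1 : ℝ) := by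
  simpa using pow_isBigO_pow_of_le (Nat.zero_le m)

theorem pow_smul_const_isBigO {X : Type*} [NormedAddCommGroup X] [NormedSpace ℝ X] (m : ℕ)
    (x : X) : (fun h : ℝ => h ^ m • x) =O[𝓝[>] 0] fun h : ℝ => h ^ m := by
  refine IsBigO.of_bound ‖x‖ (Eventually.of_forall fun h => ?_)
  rw [norm_smul, mul_comm]

/-- Stability for small h: it bounds the stage error by the defect before anything is known about
its order. -/
theorem norm_le_two_mul_norm_sub_smul {X : Type*} [NormedAddCommGroup X] [NormedSpace ℝ X]
    (T : X →L[ℝ] X) : ∀ᶠ h in 𝓝[>] (0 : ℝ), ∀ E : X, ‖E‖ ≤ 2 * ‖E - h • T E‖ := by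
  have h1 : Tendsto (fun h : ℝ => h * ‖T‖) (𝓝[>] 0) (𝓝 0) := by
    have : Continuous fun h : ℝ => h * ‖T‖ := by fun_prop
    simpa using (this.tendsto 0).mono_left (nhdsWithin_le_nhds (s := Set.Ioi 0))
  filter_upwards [h1.eventually_lt_const (show (0 : ℝ) < 1 / 2 by norm_num),
    self_mem_nhdsWithin] with h hh hpos E
  have hpos : 0 < h := hpos
  have h2 : ‖h • T E‖ ≤ h * ‖T‖ * ‖E‖ := by
    rw [norm_smul, Real.norm_of_nonneg hpos.le, mul_assoc]
    exact mul_le_mul_of_nonneg_left (T.le_opNorm E) hpos.le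
  have h3 : ‖E‖ ≤ ‖E - h • T E‖ + ‖h • T E‖ := by
    simpa using norm_add_le (E - h • T E) (h • T E)
  nlinarith [norm_nonneg E]

variable {X : Type*} [NormedAddCommGroup X] [NormedSpace ℝ X]
  {s : ℕ} {A : Matrix (Fin (s + 1)) (Fin (s + 1)) ℝ} {γ : Fin (s + 1) → ℝ} {p : ℕ}

/-- In the expansion of the defect, terms with m + k < p vanish at the last stage by the order
conditions, and the others carry h^(m+k+1) with m + k ≥ p. -/
theorem pow_mul_stageMap_pow_defect_isBigO (hA : LinearOrderConditions A γ p)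
    (hγ : γ (Fin.last s) = 1) (L : X →L[ℝ] X) {y : ℝ → X} (hy : ContDiff ℝ ((p + 1 : ℕ)) y)
    (t : ℝ) (m : ℕ) :
    (fun h : ℝ => h ^ m • (stageMap A L ^ m) (stageDefect A γ y (deriv y) t h) (Fin.last s))
      =O[𝓝[>] 0] fun h : ℝ => h ^ (p + 1) := by
  have h1 := (stageDefect_isBigO (A := A) (γ := γ) hy t).mono
    (nhdsWithin_le_nhds (s := Set.Ioi 0))
  have h2 := (isBigO_pi.1 (((stageMap A L ^ m).isBigO_comp _ _).trans h1)) (Fin.last s)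
  have h3 := (pow_isBigO_one m).smul h2
  have h4 : (fun h : ℝ => ∑ k ∈ Finset.range p, h ^ (m + (k + 1)) •
      ((A ^ m *ᵥ defectCoeff A γ k) (Fin.last s) • (L ^ m) (iteratedDeriv (k + 1) y t)))
      =O[𝓝[>] 0] fun h : ℝ => h ^ (p + 1) := by
    refine IsBigO.fun_sum fun k _ => ?_
    by_cases hmk : m + k < p
    · simp only [pow_mulVec_defectCoeff_last hA hγ hmk, zero_smul, smul_zero]
      exact isBigO_zero _ _
    · exact (pow_smul_const_isBigO _ _).trans (pow_isBigO_pow_of_le (by omega))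
  refine ((h3.congr_right fun h => by rw [one_smul]).add h4).congr_left fun h => ?_
  simp only [map_sub, map_sum, map_smul, stageMap_pow_tensor, Pi.sub_apply, Finset.sum_apply,
    Pi.smul_apply, smul_sub, Finset.smul_sum, smul_smul, pow_add, mul_assoc,
    sub_add_cancel]

theorem last_stage_isBigO (hA : LinearOrderConditions A γ p) (hγ : γ (Fin.last s) = 1)
    (L : X →L[ℝ] X) {y : ℝ → X} (hy : ContDiff ℝ ((p + 1 : ℕ)) y) (t : ℝ)
    {E : ℝ → Fin (s + 1) → X}
    (hE : ∀ᶠ h in 𝓝[>] (0 : ℝ), E h - h • stageMap A L (E h) =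
      stageDefect A γ y (deriv y) t h) :
    (fun h => E h (Fin.last s)) =O[𝓝[>] 0] fun h : ℝ => h ^ (p + 1) := by
  have hδ : (fun h => stageDefect A γ y (deriv y) t h) =O[𝓝[>] 0] fun _ : ℝ => (1 : ℝ) := by
    have h1 := ((stageDefect_isBigO (A := A) (γ := γ) hy t).mono
      (nhdsWithin_le_nhds (s := Set.Ioi 0))).trans (pow_isBigO_one (p + 1))
    have h2 : (fun h : ℝ => ∑ k ∈ Finset.range p, h ^ (k + 1) •
        fun i => defectCoeff A γ k i • iteratedDeriv (k + 1) y t)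
        =O[𝓝[>] 0] fun _ : ℝ => (1 : ℝ) :=
      IsBigO.fun_sum fun k _ => (pow_smul_const_isBigO _ _).trans (pow_isBigO_one _)
    simpa using h1.add h2
  have hEb : E =O[𝓝[>] 0] fun _ : ℝ => (1 : ℝ) := by
    refine IsBigO.trans (IsBigO.of_bound 2 ?_) hδ
    filter_upwards [hE, norm_le_two_mul_norm_sub_smul (stageMap A L)] with h h1 h2
    rw [← h1]
    exact h2 _
  have hlast := isBigO_pi.1 (((stageMap A L ^ (p + 1)).isBigO_comp E _).trans hEb) (Fin.last s)
  have h1 := (isBigO_refl (fun h : ℝ => h ^ (p + 1)) (𝓝[>] 0)).smul hlast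
  have h2 := IsBigO.fun_sum (s := Finset.range (p + 1)) fun m _ =>
    pow_mul_stageMap_pow_defect_isBigO hA hγ L hy t m
  refine (h2.add (h1.congr_right fun h => by rw [smul_eq_mul, mul_one])).congr' ?_
    EventuallyEq.rfl
  filter_upwards [hE] with h hh
  -- The finite geometric sum (∑_{m ≤ p} h^m T^m)(1 - hT) = 1 - h^(p+1) T^(p+1), applied to the
  -- error.
  have h3 := congrArg (fun B : (Fin (s + 1) → X) →L[ℝ] (Fin (s + 1) → X) => B (E h))
    (geom_sum_mul_neg (h • stageMap A L) (p + 1))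
  simp only [mul_apply_eq_comp, _root_.sub_apply, _root_.smul_apply, one_apply_eq_self, hh,
    smul_pow, _root_.sum_apply] at h3
  have h4 := congrFun h3 (Fin.last s)
  simp only [Finset.sum_apply, Pi.sub_apply, Pi.smul_apply] at h4
  rw [h4]
  abel

end Order

/-! ### Second order systems as first order systems. -/

section System

variable {s d : ℕ} {A : Matrix (Fin (s + 1)) (Fin (s + 1)) ℝ} {γ : Fin (s + 1) → ℝ} {p : ℕ}

/-- The linear part of `M U'' + C U' + K U = F` as a first order system. -/
def systemMap (M C K : Matrix (Fin d) (Fin d) ℝ) :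
    ((Fin d → ℝ) × (Fin d → ℝ)) →L[ℝ] (Fin d → ℝ) × (Fin d → ℝ) :=
  LinearMap.toContinuousLinearMap
    ((LinearMap.snd ℝ (Fin d → ℝ) (Fin d → ℝ)).prod
      (-((M⁻¹ * K).mulVecLin.comp (LinearMap.fst ℝ _ _) +
        (M⁻¹ * C).mulVecLin.comp (LinearMap.snd ℝ _ _))))

theorem systemMap_apply (M C K : Matrix (Fin d) (Fin d) ℝ) (y : (Fin d → ℝ) × (Fin d → ℝ)) :
    systemMap M C K y = (y.2, -(M⁻¹ *ᵥ (C *ᵥ y.2 + K *ᵥ y.1))) := by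
  simp [systemMap, Matrix.mulVec_add, add_comm]

theorem mulVec_add_eq_iff {M : Matrix (Fin d) (Fin d) ℝ} (hM : IsUnit M)
    (C K : Matrix (Fin d) (Fin d) ℝ) (u v a f : Fin d → ℝ) :
    M *ᵥ a + C *ᵥ v + K *ᵥ u = f ↔ a = M⁻¹ *ᵥ f + -(M⁻¹ *ᵥ (C *ᵥ v + K *ᵥ u)) := by
  have hdet : IsUnit M.det := (Matrix.isUnit_iff_isUnit_det M).1 hM
  rw [← sub_eq_add_neg, ← Matrix.mulVec_sub]
  constructor
  · rintro rfl
    rw [add_assoc, add_sub_cancel_right, Matrix.mulVec_mulVec, Matrix.nonsing_inv_mul _ hdet,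
      Matrix.one_mulVec]
  · rintro rfl
    rw [Matrix.mulVec_mulVec, Matrix.mul_nonsing_inv _ hdet, Matrix.one_mulVec]
    abel

/-- Bootstrapping: the equation gives y one more derivative than it already has, until the
smoothness of g is exhausted. -/
theorem contDiff_of_hasDerivAt_linear {X : Type*} [NormedAddCommGroup X] [NormedSpace ℝ X]
    (L : X →L[ℝ] X) {y g : ℝ → X} (hg : ContDiff ℝ p g)
    (hy : ∀ t, HasDerivAt y (L (y t) + g t) t) : ContDiff ℝ ((p + 1 : ℕ)) y := by
  have key : ∀ n : ℕ, n ≤ p + 1 → ContDiff ℝ n y := by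
    intro n
    induction n with
    | zero =>
      intro _
      exact contDiff_zero.2 (continuous_iff_continuousAt.2 fun t => (hy t).continuousAt)
    | succ n ih =>
      intro hn
      have h1 : deriv y = fun t => L (y t) + g t := funext fun t => (hy t).deriv
      have h2 : ContDiff ℝ ((n : WithTop ℕ∞) + 1) y := by
        refine contDiff_succ_iff_deriv.2 ⟨fun t => (hy t).differentiableAt, ?_, ?_⟩
        · intro h; simp at h
        · rw [h1]
          exact (L.contDiff.comp (ih (by omega))).add
            (hg.of_le (by exact_mod_cast (show n ≤ p by omega)))
      exact_mod_cast h2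
  exact key _ le_rfl

/-- Solving the equation of motion for the accelerations turns the two stage recursions into one
Runge–Kutta system for (U, V); the accelerations are then determined by the stages. -/
theorem isStep_iff {M : Matrix (Fin d) (Fin d) ℝ} (hM : IsUnit M)
    (C K : Matrix (Fin d) (Fin d) ℝ) (F : ℝ → Fin d → ℝ) (t h : ℝ) (u v : Fin d → ℝ)
    (Us Vs As : Fin (s + 1) → Fin d → ℝ) :
    IsStep A γ M C K F t h u v Us Vs As ↔
      ((fun i => (Us i, Vs i)) - h • stageMap A (systemMap M C K) (fun i => (Us i, Vs i)) =
        fun i => (u, v) + h • ∑ j, A i j • ((0 : Fin d → ℝ), M⁻¹ *ᵥ F (t + γ j * h))) ∧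
      ∀ i, As i = M⁻¹ *ᵥ F (t + γ i * h) + -(M⁻¹ *ᵥ (C *ᵥ Vs i + K *ᵥ Us i)) := by
  have hs : ∀ (i : Fin (s + 1)) (f : Fin (s + 1) → (Fin d → ℝ) × (Fin d → ℝ)),
      ∑ j, A i j • f j = (∑ j, A i j • (f j).1, ∑ j, A i j • (f j).2) := by
    intro i f
    ext1 <;> simp [Prod.fst_sum, Prod.snd_sum]
  constructor
  · intro H
    have hA : ∀ i, As i = M⁻¹ *ᵥ F (t + γ i * h) + -(M⁻¹ *ᵥ (C *ᵥ Vs i + K *ᵥ Us i)) :=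
      fun i => (mulVec_add_eq_iff hM C K _ _ _ _).1 (H i).1
    refine ⟨funext fun i => ?_, hA⟩
    obtain ⟨-, h2, h3⟩ := H i
    rw [Pi.sub_apply, Pi.smul_apply, stageMap_apply, sub_eq_iff_eq_add, hs, hs]
    simp only [systemMap_apply]
    ext1
    · simpa using h2
    · simp only [Prod.snd_add, Prod.smul_snd]
      rw [h3]
      simp only [hA, smul_add, Finset.sum_add_distrib, add_assoc]
  · rintro ⟨H, hA⟩ i
    refine ⟨(mulVec_add_eq_iff hM C K _ _ _ _).2 (hA i), ?_⟩
    have h1 := congrFun H i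
    rw [Pi.sub_apply, Pi.smul_apply, stageMap_apply, sub_eq_iff_eq_add, hs, hs] at h1
    simp only [systemMap_apply] at h1
    constructor
    · simpa using congrArg Prod.fst h1
    · have h2 := congrArg Prod.snd h1
      simp only [Prod.snd_add, Prod.smul_snd] at h2
      rw [h2]
      simp only [hA, smul_add, Finset.sum_add_distrib, add_assoc]

theorem hasOrder_of_linearOrderConditions (hA : LinearOrderConditions A γ p)
    (hγ : γ (Fin.last s) = 1) : HasOrder A γ p := by
  intro d M C K hM F hF U V W hU hV hW t
  set L := systemMap M C K with hL
  set g : ℝ → (Fin d → ℝ) × (Fin d → ℝ) := fun t => (0, M⁻¹ *ᵥ F t) with hg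
  set y : ℝ → (Fin d → ℝ) × (Fin d → ℝ) := fun t => (U t, V t) with hy
  have hW' : ∀ t, W t = M⁻¹ *ᵥ F t + -(M⁻¹ *ᵥ (C *ᵥ V t + K *ᵥ U t)) := fun t =>
    (mulVec_add_eq_iff hM C K _ _ _ _).1 (hW t)
  have hyd : ∀ t, HasDerivAt y (L (y t) + g t) t := by
    intro t
    have e : L (y t) + g t = (V t, W t) := by
      rw [hL, systemMap_apply, hW' t]
      ext1 <;> simp [hg, hy, add_comm]
    rw [e]
    exact (hU t).prodMk (hV t)
  have hgc : ContDiff ℝ p g :=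
    contDiff_const.prodMk ((M⁻¹.mulVecLin.toContinuousLinearMap).contDiff.comp hF)
  have hyc := contDiff_of_hasDerivAt_linear L hgc hyd
  set T := stageMap A L with hT
  set rhs : ℝ → Fin (s + 1) → (Fin d → ℝ) × (Fin d → ℝ) := fun h i =>
    y t + h • ∑ j, A i j • g (t + γ j * h) with hrhs
  have hunit : ∀ᶠ h in 𝓝[>] (0 : ℝ), IsUnit (1 - h • T) := by
    have h1 : Tendsto (fun h : ℝ => ‖h • T‖) (𝓝[>] 0) (𝓝 0) := by
      have : Continuous fun h : ℝ => ‖h • T‖ := by fun_prop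
      simpa using (this.tendsto 0).mono_left (nhdsWithin_le_nhds (s := Set.Ioi 0))
    filter_upwards [h1.eventually_lt_const one_pos] with h hh
    exact isUnit_one_sub_of_norm_lt_one hh
  -- `Ring.inverse` is zero at non-units, so the stages are defined for every h; only small h
  -- matters.
  set Y : ℝ → Fin (s + 1) → (Fin d → ℝ) × (Fin d → ℝ) := fun h =>
    Ring.inverse (1 - h • T) (rhs h) with hY
  have hYeq : ∀ h, IsUnit (1 - h • T) → Y h - h • T (Y h) = rhs h := by
    intro h hh
    have := congrArg (fun B : (Fin (s + 1) → (Fin d → ℝ) × (Fin d → ℝ)) →L[ℝ]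
      (Fin (s + 1) → (Fin d → ℝ) × (Fin d → ℝ)) => B (rhs h)) (Ring.mul_inverse_cancel _ hh)
    simpa [mul_apply_eq_comp] using this
  have hYuniq : ∀ h, IsUnit (1 - h • T) → ∀ Z, Z - h • T Z = rhs h → Z = Y h := by
    intro h hh Z hZ
    have := congrArg (fun B : (Fin (s + 1) → (Fin d → ℝ) × (Fin d → ℝ)) →L[ℝ]
      (Fin (s + 1) → (Fin d → ℝ) × (Fin d → ℝ)) => B Z) (Ring.inverse_mul_cancel _ hh)
    simp only [hY]
    rw [← hZ]
    simpa [mul_apply_eq_comp] using this.symm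
  have herr : (fun h => Y h (Fin.last s) - y (t + h)) =O[𝓝[>] 0] fun h : ℝ => h ^ (p + 1) := by
    have := last_stage_isBigO hA hγ L hyc t (E := fun h => Y h - fun i => y (t + γ i * h)) ?_
    · refine this.congr_left fun h => ?_
      simp [hγ]
    · filter_upwards [hunit] with h hh
      have h1 := hYeq h hh
      rw [map_sub, smul_sub, sub_sub_sub_comm, h1]
      funext i
      simp only [Pi.sub_apply, Pi.smul_apply, stageDefect, hrhs, stageMap_apply,
        (hyd _).deriv, smul_add, Finset.sum_add_distrib]
      abel
  have herrU : (fun h => (Y h (Fin.last s)).1 - U (t + h)) =O[𝓝[>] 0]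
      fun h : ℝ => h ^ (p + 1) :=
    IsBigO.trans (IsBigO.of_bound 1 (Eventually.of_forall fun h => by
      rw [one_mul]; exact norm_fst_le (Y h (Fin.last s) - y (t + h)))) herr
  have herrV : (fun h => (Y h (Fin.last s)).2 - V (t + h)) =O[𝓝[>] 0]
      fun h : ℝ => h ^ (p + 1) :=
    IsBigO.trans (IsBigO.of_bound 1 (Eventually.of_forall fun h => by
      rw [one_mul]; exact norm_snd_le (Y h (Fin.last s) - y (t + h)))) herr
  refine ⟨fun h i => (Y h i).1, fun h i => (Y h i).2, fun h i => M⁻¹ *ᵥ F (t + γ i * h) +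
    -(M⁻¹ *ᵥ (C *ᵥ (Y h i).2 + K *ᵥ (Y h i).1)), ?_, herrU, herrV, ?_⟩
  · filter_upwards [hunit] with h hh
    refine ⟨(isStep_iff hM C K F t h _ _ _ _ _).2 ⟨hYeq h hh, fun i => rfl⟩, ?_⟩
    intro Us' Vs' As' H
    obtain ⟨h1, h2⟩ := (isStep_iff hM C K F t h _ _ _ _ _).1 H
    have h3 := hYuniq h hh _ h1
    have h4 : ∀ i, Us' i = (Y h i).1 := fun i => congrArg Prod.fst (congrFun h3 i)
    have h5 : ∀ i, Vs' i = (Y h i).2 := fun i => congrArg Prod.snd (congrFun h3 i)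
    refine ⟨funext h4, funext h5, funext fun i => ?_⟩
    rw [h2 i, h4, h5]
  -- The numerical and exact accelerations are the same affine function of the state at time t + h,
  -- because γ_s = 1, so the acceleration error is a bounded linear image of the state error.
  · set N : ((Fin d → ℝ) × (Fin d → ℝ)) →L[ℝ] (Fin d → ℝ) :=
      (ContinuousLinearMap.snd ℝ _ _).comp L with hN
    refine ((N.isBigO_comp _ _).trans herr).congr_left fun h => ?_
    simp only [hγ, one_mul, hW', hN, hL, map_sub, ContinuousLinearMap.comp_apply,
      systemMap_apply, hy, ContinuousLinearMap.coe_snd']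
    abel

end System

/-! ### Amplification matrix and load operator of the oscillator. -/

section SingleDegreeOfFreedom

variable {s : ℕ} {A : Matrix (Fin (s + 1)) (Fin (s + 1)) ℝ} {γ : Fin (s + 1) → ℝ} {p : ℕ}

theorem stageMatrix_mulVec (ξ ω h : ℝ) (V W : Fin (s + 1) → ℝ) :
    stageMatrix A ξ ω h *ᵥ Sum.elim V W =
      Sum.elim ((2 * ξ * ω) • V + (ω ^ 2 * h) • (A *ᵥ V) + W) (V - h • (A *ᵥ W)) := by
  rw [stageMatrix, Matrix.fromBlocks_mulVec]
  simp only [Sum.elim_comp_inl, Sum.elim_comp_inr, Matrix.add_mulVec, Matrix.smul_mulVec,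
    Matrix.one_mulVec, Matrix.neg_mulVec, sub_eq_add_neg]

theorem updateMatrix_mulVec (h : ℝ) (V W : Fin (s + 1) → ℝ) :
    updateMatrix A h *ᵥ Sum.elim V W =
      ![h * (A *ᵥ V) (Fin.last s), h * (A *ᵥ W) (Fin.last s)] := by
  ext i
  fin_cases i <;>
    simp [updateMatrix, Matrix.mulVec, dotProduct, Finset.mul_sum, mul_assoc]

theorem update_mul_inv_mulVec {ξ ω h : ℝ} (hS : IsUnit (stageMatrix A ξ ω h))
    {V W : Fin (s + 1) → ℝ} {x : Fin (s + 1) ⊕ Fin (s + 1) → ℝ}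
    (hx : stageMatrix A ξ ω h *ᵥ Sum.elim V W = x) :
    (updateMatrix A h * (stageMatrix A ξ ω h)⁻¹) *ᵥ x =
      ![h * (A *ᵥ V) (Fin.last s), h * (A *ᵥ W) (Fin.last s)] := by
  rw [← hx, Matrix.mulVec_mulVec, Matrix.mul_assoc,
    Matrix.nonsing_inv_mul _ ((Matrix.isUnit_iff_isUnit_det _).1 hS), Matrix.mul_one,
    updateMatrix_mulVec]

/-- Substituting U_i = u + h(AV)_i into the equation of motion leaves f - ω²u on the right-hand
side, so `B S⁻¹` maps this data to the increment over one step. -/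
theorem update_mul_inv_mulVec_of_isStep {ξ ω h t : ℝ} (hS : IsUnit (stageMatrix A ξ ω h))
    {F : ℝ → Fin 1 → ℝ} {u v : Fin 1 → ℝ} {Us Vs As : Fin (s + 1) → Fin 1 → ℝ}
    (H : IsStep A γ 1 ((2 * ξ * ω) • 1) ((ω ^ 2) • 1) F t h u v Us Vs As) :
    (updateMatrix A h * (stageMatrix A ξ ω h)⁻¹) *ᵥ
        Sum.elim (fun i => F (t + γ i * h) 0 - ω ^ 2 * u 0) (fun _ => v 0) =
      ![Us (Fin.last s) 0 - u 0, Vs (Fin.last s) 0 - v 0] := by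
  have hU : ∀ i, Us i 0 = u 0 + h * (A *ᵥ fun j => Vs j 0) i := fun i => by
    have := congrFun (H i).2.1 0
    simpa [Finset.sum_apply, Matrix.mulVec, dotProduct] using this
  have hV : ∀ i, Vs i 0 = v 0 + h * (A *ᵥ fun j => As j 0) i := fun i => by
    have := congrFun (H i).2.2 0
    simpa [Finset.sum_apply, Matrix.mulVec, dotProduct] using this
  have hF : ∀ i, As i 0 + 2 * ξ * ω * Vs i 0 + ω ^ 2 * Us i 0 = F (t + γ i * h) 0 := fun i => by
    have := congrFun (H i).1 0
    simpa [Matrix.smul_mulVec] using this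
  rw [update_mul_inv_mulVec hS (V := fun j => Vs j 0) (W := fun j => As j 0)]
  · rw [hU, hV (Fin.last s)]
    simp
  · rw [stageMatrix_mulVec]
    congr 1
    · funext i
      have h1 := hU i
      have h2 := hF i
      simp only [Pi.add_apply, Pi.smul_apply, smul_eq_mul]
      rw [← h2, h1]
      ring
    · funext i
      have h1 := hV i
      simp only [Pi.sub_apply, Pi.smul_apply, smul_eq_mul]
      linarith

theorem eventually_isUnit_stageMatrix (A : Matrix (Fin (s + 1)) (Fin (s + 1)) ℝ) (ξ ω : ℝ) :
    ∀ᶠ h in 𝓝[>] (0 : ℝ), IsUnit (stageMatrix A ξ ω h) := by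
  have h0 : (stageMatrix A ξ ω 0).det ≠ 0 := by
    -- At h = 0 the stage matrix has an explicit inverse; continuity of the determinant does the
    -- rest.
    have : stageMatrix A ξ ω 0 * Matrix.fromBlocks 0 1 1 (-((2 * ξ * ω) • 1)) = 1 := by
      simp [stageMatrix, Matrix.fromBlocks_multiply, Matrix.fromBlocks_one]
    intro h
    have h2 := congrArg Matrix.det this
    rw [Matrix.det_mul, h, zero_mul, Matrix.det_one] at h2
    exact zero_ne_one h2
  have hc : Continuous fun h => (stageMatrix A ξ ω h).det := by
    refine Continuous.matrix_det ?_
    unfold stageMatrix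
    fun_prop
  have h1 : ∀ᶠ h in 𝓝 (0 : ℝ), (stageMatrix A ξ ω h).det ≠ 0 :=
    (hc.tendsto 0).eventually_ne h0
  filter_upwards [h1.filter_mono nhdsWithin_le_nhds] with h hh
  exact (Matrix.isUnit_iff_isUnit_det _).2 (isUnit_iff_ne_zero.2 hh)

/-- One estimate serves both operators: f = 0 with initial states (1, 0) and (0, 1) gives the
columns of `Dnum`, and f = exp with zero initial state gives `Lnum`. -/
theorem update_mul_inv_sub_isBigO (hA : HasOrder A γ p) (ξ ω : ℝ) {f U V : ℝ → ℝ}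
    (hf : ContDiff ℝ p f) (hU : ∀ t, HasDerivAt U (V t) t)
    (hV : ∀ t, HasDerivAt V (f t - 2 * ξ * ω * V t - ω ^ 2 * U t) t) (i : Fin 2) :
    (fun h => ((updateMatrix A h * (stageMatrix A ξ ω h)⁻¹) *ᵥ
        Sum.elim (fun i => f (γ i * h) - ω ^ 2 * U 0) (fun _ => V 0)) i -
          ![U h - U 0, V h - V 0] i)
      =O[𝓝[>] 0] fun h : ℝ => h ^ (p + 1) := by
  obtain ⟨Us, Vs, As, hstep, hUs, hVs, -⟩ := hA 1 1 ((2 * ξ * ω) • 1) ((ω ^ 2) • 1) isUnit_one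
    (fun t _ => f t) (contDiff_pi.2 fun _ => hf) (fun t _ => U t) (fun t _ => V t)
    (fun t _ => f t - 2 * ξ * ω * V t - ω ^ 2 * U t) (fun t => hasDerivAt_pi.2 fun _ => hU t)
    (fun t => hasDerivAt_pi.2 fun _ => hV t) (fun t => by
      funext i
      simp [Matrix.smul_mulVec]
      ring) 0
  have hU0 := isBigO_pi.1 hUs 0
  have hV0 := isBigO_pi.1 hVs 0
  have key : ∀ᶠ h in 𝓝[>] (0 : ℝ), (updateMatrix A h * (stageMatrix A ξ ω h)⁻¹) *ᵥ
      Sum.elim (fun i => f (γ i * h) - ω ^ 2 * U 0) (fun _ => V 0) =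
        ![Us h (Fin.last s) 0 - U 0, Vs h (Fin.last s) 0 - V 0] := by
    filter_upwards [hstep, eventually_isUnit_stageMatrix A ξ ω] with h h1 h2
    have := update_mul_inv_mulVec_of_isStep h2 h1.1
    simpa using this
  fin_cases i
  · refine hU0.congr' ?_ EventuallyEq.rfl
    filter_upwards [key] with h hh
    simp [hh]
  · refine hV0.congr' ?_ EventuallyEq.rfl
    filter_upwards [key] with h hh
    simp [hh]

theorem hasDerivAt_exp_mul_cos_add_sin (a w c d t : ℝ) :
    HasDerivAt (fun t => Real.exp (a * t) * (c * Real.cos (w * t) + d * Real.sin (w * t)))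
      (Real.exp (a * t) * ((a * c + w * d) * Real.cos (w * t) +
        (a * d - w * c) * Real.sin (w * t))) t := by
  have hl : ∀ b : ℝ, HasDerivAt (fun t => b * t) b t := fun b => by
    simpa using (hasDerivAt_id t).const_mul b
  have h1 := (hl a).exp
  have h2 := ((hl w).cos.const_mul c).add ((hl w).sin.const_mul d)
  refine (h1.mul h2).congr_deriv ?_
  simp only [Pi.add_apply]
  ring

theorem dampedFreq_pos {ξ ω : ℝ} (hξ0 : 0 ≤ ξ) (hξ1 : ξ < 1) (hω : 0 < ω) :
    0 < dampedFreq ξ ω :=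
  mul_pos (Real.sqrt_pos.2 (by nlinarith)) hω

theorem dampedFreq_sq {ξ ω : ℝ} (hξ0 : 0 ≤ ξ) (hξ1 : ξ < 1) :
    dampedFreq ξ ω ^ 2 = ω ^ 2 - (ξ * ω) ^ 2 := by
  rw [dampedFreq, mul_pow, Real.sq_sqrt (by nlinarith)]
  ring

theorem Dnum_apply (ξ ω h : ℝ) (i j : Fin 2) :
    Dnum A ξ ω h i j = (1 : Matrix (Fin 2) (Fin 2) ℝ) i j +
      ((updateMatrix A h * (stageMatrix A ξ ω h)⁻¹) *ᵥ fun k => inputMatrix s ω k j) i := rfl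

theorem inputMatrix_col_zero (ω : ℝ) :
    (fun k => inputMatrix s ω k 0) = Sum.elim (fun _ => -ω ^ 2) fun _ => 0 := by
  funext k
  rcases k with k | k <;> simp [inputMatrix]

theorem inputMatrix_col_one (ω : ℝ) :
    (fun k => inputMatrix s ω k 1) = Sum.elim (fun _ => 0) fun _ => 1 := by
  funext k
  rcases k with k | k <;> simp [inputMatrix]

theorem Dnum_sub_Dexa_isBigO (hA : HasOrder A γ p) {ξ ω : ℝ} (hξ0 : 0 ≤ ξ) (hξ1 : ξ < 1)
    (hω : 0 < ω) (i j : Fin 2) :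
    (fun h => Dnum A ξ ω h i j - Dexa ξ ω h i j) =O[𝓝[>] 0] fun h : ℝ => h ^ (p + 1) := by
  have hw := (dampedFreq_pos hξ0 hξ1 hω).ne'
  have hw2 := dampedFreq_sq (ω := ω) hξ0 hξ1
  have main : ∀ U V : ℝ → ℝ, (∀ t, HasDerivAt U (V t) t) →
      (∀ t, HasDerivAt V (0 - 2 * ξ * ω * V t - ω ^ 2 * U t) t) → ∀ i : Fin 2,
      (fun h => ((updateMatrix A h * (stageMatrix A ξ ω h)⁻¹) *ᵥ
        Sum.elim (fun _ => 0 - ω ^ 2 * U 0) (fun _ => V 0)) i - ![U h - U 0, V h - V 0] i)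
      =O[𝓝[>] 0] fun h : ℝ => h ^ (p + 1) := fun U V hU hV i =>
    update_mul_inv_sub_isBigO hA ξ ω (f := fun _ => 0) contDiff_const hU hV i
  set w := dampedFreq ξ ω with hwdef
  fin_cases j
  · have := main
      (fun t => Real.exp (-(ξ * ω) * t) * (1 * Real.cos (w * t) + ξ * ω / w * Real.sin (w * t)))
      (fun t => Real.exp (-(ξ * ω) * t) * (0 * Real.cos (w * t) +
        (-(ω ^ 2 / w)) * Real.sin (w * t)))
      (fun t => by
        refine (hasDerivAt_exp_mul_cos_add_sin _ _ _ _ t).congr_deriv ?_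
        have : -(ξ * ω) * (ξ * ω / w) - w * 1 = -(ω ^ 2 / w) := by
          field_simp
          linarith
        rw [this]
        field_simp
        ring)
      (fun t => by
        refine (hasDerivAt_exp_mul_cos_add_sin _ _ _ _ t).congr_deriv ?_
        field_simp
        ring) i
    refine this.congr_left fun h => ?_
    rw [Dnum_apply]
    change _ = _ + ((updateMatrix A h * (stageMatrix A ξ ω h)⁻¹) *ᵥ
      fun k => inputMatrix s ω k 0) i - Dexa ξ ω h i 0
    rw [inputMatrix_col_zero]
    fin_cases i
    · simp [Dexa, ← hwdef]
      ring
    · simp [Dexa, ← hwdef]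
  · have := main
      (fun t => Real.exp (-(ξ * ω) * t) * (0 * Real.cos (w * t) + 1 / w * Real.sin (w * t)))
      (fun t => Real.exp (-(ξ * ω) * t) * (1 * Real.cos (w * t) +
        (-(ξ * ω / w)) * Real.sin (w * t)))
      (fun t => by
        refine (hasDerivAt_exp_mul_cos_add_sin _ _ _ _ t).congr_deriv ?_
        field_simp
        ring)
      (fun t => by
        refine (hasDerivAt_exp_mul_cos_add_sin _ _ _ _ t).congr_deriv ?_
        have : -(ξ * ω) * (-(ξ * ω / w)) - w * 1 = 2 * ξ * ω * (ξ * ω / w) - ω ^ 2 / w := by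
          field_simp
          linarith
        rw [this]
        field_simp
        ring) i
    refine this.congr_left fun h => ?_
    rw [Dnum_apply]
    change _ = _ + ((updateMatrix A h * (stageMatrix A ξ ω h)⁻¹) *ᵥ
      fun k => inputMatrix s ω k 1) i - Dexa ξ ω h i 1
    rw [inputMatrix_col_one]
    fin_cases i
    · simp [Dexa, ← hwdef]
    · simp [Dexa, ← hwdef]
      ring

theorem Lnum_sub_Lexa_isBigO (hA : HasOrder A γ p) {ξ ω : ℝ} (hξ0 : 0 ≤ ξ) (hξ1 : ξ < 1)
    (hω : 0 < ω) (i : Fin 2) :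
    (fun h => Lnum A γ ξ ω h i - Lexa ξ ω h i) =O[𝓝[>] 0] fun h : ℝ => h ^ (p + 1) := by
  have hw := (dampedFreq_pos hξ0 hξ1 hω).ne'
  have hw2 := dampedFreq_sq (ω := ω) hξ0 hξ1
  have hN : ω ^ 2 + 2 * ξ * ω + 1 ≠ 0 := by positivity
  set w := dampedFreq ξ ω with hwdef
  set N := ω ^ 2 + 2 * ξ * ω + 1 with hNdef
  -- The particular solution e^t/N, with N the characteristic polynomial at 1, is corrected by a
  -- homogeneous solution so that displacement and velocity vanish at time 0.
  have := update_mul_inv_sub_isBigO hA ξ ω (f := Real.exp)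
    (U := fun t => Real.exp t / N - Real.exp (-(ξ * ω) * t) *
      (1 / N * Real.cos (w * t) + (1 + ξ * ω) / (w * N) * Real.sin (w * t)))
    (V := fun t => Real.exp t / N - Real.exp (-(ξ * ω) * t) *
      (1 / N * Real.cos (w * t) + (-(ω ^ 2 + ξ * ω) / (w * N)) * Real.sin (w * t)))
    Real.contDiff_exp
    (fun t => by
      refine (((Real.hasDerivAt_exp t).div_const N).sub
        (hasDerivAt_exp_mul_cos_add_sin _ _ _ _ t)).congr_deriv ?_
      have : -(ξ * ω) * ((1 + ξ * ω) / (w * N)) - w * (1 / N) =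
          -(ω ^ 2 + ξ * ω) / (w * N) := by
        field_simp
        linarith
      rw [this]
      field_simp
      ring)
    (fun t => by
      refine (((Real.hasDerivAt_exp t).div_const N).sub
        (hasDerivAt_exp_mul_cos_add_sin _ _ _ _ t)).congr_deriv ?_
      have e1 : -(ξ * ω) * (-(ω ^ 2 + ξ * ω) / (w * N)) - w * (1 / N) =
          ω ^ 2 * (ξ * ω - 1) / (w * N) + 2 * ξ * ω * (ξ * ω) / (w * N) := by
        field_simp
        linarith
      rw [e1]
      have e2 : Real.exp t = (ω ^ 2 + 2 * ξ * ω + 1) * (Real.exp t / N) := by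
        rw [← hNdef]; field_simp
      generalize hE : Real.exp t / N = E at e2 ⊢
      rw [e2]
      field_simp
      ring) i
  refine this.congr_left fun h => ?_
  fin_cases i
  · simp [Lnum, Lexa, ← hwdef, ← hNdef]
    field_simp
  · simp [Lnum, Lexa, ← hwdef, ← hNdef]
    field_simp
    ring

end SingleDegreeOfFreedom

/-! ### The high-frequency limit. -/

section HighFrequency

variable {s : ℕ} {A : Matrix (Fin (s + 1)) (Fin (s + 1)) ℝ}

/-- Z = Y - w ⊗ x has zeroth entry 0, so A may be replaced on it by the invertible A + E₀₀.
Inverting τ((A + E₀₀) ⊗ J)Z = Z - (1 - w) ⊗ x bounds τ‖Z‖ by K(‖Z‖ + ‖1 - w‖‖x‖), and for τ ≥ 2K the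
term K‖Z‖ is absorbed. -/
theorem exists_stiff_bound {X : Type*} [NormedAddCommGroup X] [NormedSpace ℝ X]
    {J J' : X →L[ℝ] X} (hJ : J' * J = 1) (hrow : ∀ j, A 0 j = 0)
    (hunit : IsUnit (A + Matrix.single 0 0 1)) {w : Fin (s + 1) → ℝ} (hw : A *ᵥ w = 0)
    (hw0 : w 0 = 1) :
    ∃ C : ℝ, 0 < C ∧ ∀ τ : ℝ, C ≤ τ → ∀ (x : X) (Y : Fin (s + 1) → X),
      Y = (fun _ => x) + τ • stageMap A J Y → ‖Y - fun i => w i • x‖ ≤ C * ‖x‖ / τ := by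
  obtain ⟨B, hB⟩ := hunit.exists_left_inv
  set K := ‖stageMap B J'‖ with hK
  set e : Fin (s + 1) → ℝ := fun i => 1 - w i with he
  have hK0 : 0 ≤ K := norm_nonneg _
  have he0 : 0 ≤ ‖e‖ := norm_nonneg e
  have hC : 0 < 2 * K * (1 + ‖e‖) + 1 := by positivity
  refine ⟨_, hC, fun τ hτ x Y hY => ?_⟩
  have hτ0 : 0 < τ := hC.trans_le hτ
  set Z := Y - fun i => w i • x with hZ
  have hTZ : stageMap A J Z = stageMap A J Y := by
    rw [hZ, map_sub, stageMap_tensor, hw]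
    ext i
    simp
  have hZ0 : Z 0 = 0 := by
    have : Y 0 = x + τ • stageMap A J Y 0 := congrFun hY 0
    rw [stageMap_apply] at this
    simp only [hrow, zero_smul, Finset.sum_const_zero, smul_zero, add_zero] at this
    simp [hZ, this, hw0]
  have hT' : stageMap (A + Matrix.single 0 0 1) J Z = stageMap A J Z := by
    ext i
    rw [stageMap_apply, stageMap_apply]
    refine Finset.sum_congr rfl fun j _ => ?_
    rw [Matrix.add_apply, add_smul, Matrix.single_apply]
    split_ifs with h
    · rw [← h.2, hZ0]; simp
    · simp
  have h1 : τ • stageMap A J Z = Z - fun i => e i • x := by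
    rw [hTZ, hZ]
    have : τ • stageMap A J Y = Y - fun _ => x := by
      rw [eq_sub_iff_add_eq, add_comm (τ • _)]; exact hY.symm
    rw [this]
    ext i
    simp only [he, Pi.sub_apply, sub_smul, one_smul]
    abel
  have h2 : τ • Z = stageMap B J' (Z - fun i => e i • x) := by
    rw [← h1, ← hT', map_smul, ← mul_apply_eq_comp, stageMap_mul, hB, hJ, stageMap_one]
    rfl
  have h3 : ‖fun i => e i • x‖ ≤ ‖e‖ * ‖x‖ := by
    refine (pi_norm_le_iff_of_nonneg (by positivity)).2 fun i => ?_
    rw [norm_smul]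
    exact mul_le_mul_of_nonneg_right (norm_le_pi_norm e i) (norm_nonneg _)
  have h4 : τ * ‖Z‖ ≤ K * (‖Z‖ + ‖e‖ * ‖x‖) := by
    calc τ * ‖Z‖ = ‖τ • Z‖ := by rw [norm_smul, Real.norm_of_nonneg hτ0.le]
      _ ≤ K * ‖Z - fun i => e i • x‖ := by rw [h2]; exact ContinuousLinearMap.le_opNorm _ _
      _ ≤ K * (‖Z‖ + ‖e‖ * ‖x‖) :=
        mul_le_mul_of_nonneg_left ((norm_sub_le _ _).trans (by gcongr)) hK0
  rw [le_div_iff₀ hτ0]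
  have hZn := norm_nonneg Z
  have hxn := norm_nonneg x
  have h5 : 2 * K * ‖Z‖ ≤ τ * ‖Z‖ :=
    mul_le_mul_of_nonneg_right (by nlinarith [mul_nonneg hK0 he0]) hZn
  nlinarith [mul_nonneg hK0 hxn]

/-- The matrix of the oscillator for the displacement and the velocity divided by `ω`, in units of `ω`. -/
def oscillatorMap (ξ : ℝ) : (ℝ × ℝ) →L[ℝ] ℝ × ℝ :=
  (ContinuousLinearMap.snd ℝ ℝ ℝ).prod
    (-ContinuousLinearMap.fst ℝ ℝ ℝ - (2 * ξ) • ContinuousLinearMap.snd ℝ ℝ ℝ)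

/-- The inverse of `oscillatorMap`. -/
def oscillatorMapInv (ξ : ℝ) : (ℝ × ℝ) →L[ℝ] ℝ × ℝ :=
  (-ContinuousLinearMap.snd ℝ ℝ ℝ - (2 * ξ) • ContinuousLinearMap.fst ℝ ℝ ℝ).prod
    (ContinuousLinearMap.fst ℝ ℝ ℝ)

theorem oscillatorMapInv_mul (ξ : ℝ) : oscillatorMapInv ξ * oscillatorMap ξ = 1 := by
  refine ContinuousLinearMap.ext fun y => ?_
  ext1 <;> simp [mul_apply_eq_comp, oscillatorMap, oscillatorMapInv]

/-- Measuring velocity in units of ω makes the system matrix ω times a fixed invertible J, so that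
hω is the only stiffness parameter. -/
theorem scaled_stage_equation {ξ ω h u v : ℝ} (hω : ω ≠ 0) {V W : Fin (s + 1) → ℝ}
    (H : stageMatrix A ξ ω h *ᵥ Sum.elim V W = Sum.elim (fun _ => -ω ^ 2 * u) fun _ => v) :
    (fun i => (u + h * (A *ᵥ V) i, V i / ω)) = (fun _ => (u, v / ω)) +
      (h * ω) • stageMap A (oscillatorMap ξ) fun i => (u + h * (A *ᵥ V) i, V i / ω) := by
  rw [stageMatrix_mulVec] at H
  have hW : ∀ i, W i = -ω ^ 2 * (u + h * (A *ᵥ V) i) - 2 * ξ * ω * V i := fun i => by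
    have := congrFun H (Sum.inl i)
    simp only [Sum.elim_inl, Pi.add_apply, Pi.smul_apply, smul_eq_mul] at this
    linarith
  have hV : ∀ i, V i = v + h * (A *ᵥ W) i := fun i => by
    have := congrFun H (Sum.inr i)
    simp only [Sum.elim_inr, Pi.sub_apply, Pi.smul_apply, smul_eq_mul] at this
    linarith
  funext i
  rw [Pi.add_apply, Pi.smul_apply, stageMap_apply]
  ext1
  · simp only [Prod.fst_add, Prod.smul_fst, Prod.fst_sum, smul_eq_mul, oscillatorMap,
      ContinuousLinearMap.prod_apply, ContinuousLinearMap.coe_snd', Matrix.mulVec, dotProduct,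
      Finset.mul_sum]
    congr 1
    refine Finset.sum_congr rfl fun j _ => ?_
    field_simp
  · simp only [Prod.snd_add, Prod.smul_snd, Prod.snd_sum, smul_eq_mul, oscillatorMap,
      ContinuousLinearMap.prod_apply, ContinuousLinearMap.coe_snd', ContinuousLinearMap.coe_fst',
      _root_.sub_apply, _root_.neg_apply, _root_.smul_apply]
    rw [hV i, add_div]
    congr 1
    rw [Matrix.mulVec, dotProduct, Finset.mul_sum, Finset.mul_sum, Finset.sum_div]
    refine Finset.sum_congr rfl fun j _ => ?_
    rw [hW j]
    field_simp

theorem eventually_stage_bound (hrow : ∀ j, A 0 j = 0)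
    (hunit : IsUnit (A + Matrix.single 0 0 1)) {w : Fin (s + 1) → ℝ} (hw : A *ᵥ w = 0)
    (hw0 : w 0 = 1) (ξ : ℝ) {h : ℝ} (hh : 0 < h) :
    ∃ C : ℝ, 0 < C ∧ ∀ᶠ ω in atTop, ∀ (u v : ℝ) (V W : Fin (s + 1) → ℝ),
      stageMatrix A ξ ω h *ᵥ Sum.elim V W = Sum.elim (fun _ => -ω ^ 2 * u) (fun _ => v) →
      ∀ i, |u + h * (A *ᵥ V) i - w i * u| ≤ C * max |u| |v / ω| / ω ∧
        |V i - w i * v| ≤ C * max |u| |v / ω| := by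
  obtain ⟨C, hC, H⟩ := exists_stiff_bound (oscillatorMapInv_mul ξ) hrow hunit hw hw0
  refine ⟨C / h, by positivity, ?_⟩
  filter_upwards [eventually_gt_atTop 0, eventually_ge_atTop (C / h)] with ω hω hωC u v V W hS i
  have hτ : C ≤ h * ω := by
    rw [div_le_iff₀ hh] at hωC; linarith
  have h1 := H _ hτ _ _ (scaled_stage_equation hω.ne' hS)
  have h2 := (norm_le_pi_norm _ i).trans h1
  rw [Prod.norm_def, Prod.norm_def, max_le_iff] at h2
  simp only [Pi.sub_apply, Prod.fst_sub, Prod.snd_sub, Prod.smul_fst, Prod.smul_snd, smul_eq_mul,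
    Real.norm_eq_abs] at h2
  constructor
  · refine h2.1.trans (le_of_eq ?_)
    field_simp
  · have e : V i - w i * v = ω * (V i / ω - w i * (v / ω)) := by field_simp
    rw [e, abs_mul, abs_of_pos hω]
    refine (mul_le_mul_of_nonneg_left h2.2 hω.le).trans (le_of_eq ?_)
    field_simp

/-- The stage bound with u = v = 0 forces V = 0, and then the first block row forces W = 0;
injectivity suffices for a square matrix. -/
theorem eventually_isUnit_stageMatrix_atTop (hrow : ∀ j, A 0 j = 0)
    (hunit : IsUnit (A + Matrix.single 0 0 1)) {w : Fin (s + 1) → ℝ} (hw : A *ᵥ w = 0)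
    (hw0 : w 0 = 1) (ξ : ℝ) {h : ℝ} (hh : 0 < h) :
    ∀ᶠ ω in atTop, IsUnit (stageMatrix A ξ ω h) := by
  obtain ⟨C, hC, H⟩ := eventually_stage_bound hrow hunit hw hw0 ξ hh
  filter_upwards [H] with ω H
  refine Matrix.mulVec_injective_iff_isUnit.1 ?_
  refine (injective_iff_map_eq_zero (stageMatrix A ξ ω h).mulVecLin).2 fun x hx => ?_
  obtain ⟨V, W, rfl⟩ : ∃ V W : Fin (s + 1) → ℝ, x = Sum.elim V W :=
    ⟨x ∘ Sum.inl, x ∘ Sum.inr, (Sum.elim_comp_inl_inr x).symm⟩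
  rw [Matrix.mulVecLin_apply] at hx
  have hV : V = 0 := by
    funext i
    have := (H 0 0 V W (by rw [hx]; ext (i | i) <;> simp) i).2
    simpa using this
  rw [stageMatrix_mulVec, hV] at hx
  have hW : W = 0 := by
    funext i
    have := congrFun hx (Sum.inl i)
    simpa using this
  rw [hV, hW]
  ext (i | i) <;> rfl

theorem hasDoubleEigenvalueAtInfinity_of_kernel (hrow : ∀ j, A 0 j = 0)
    (hunit : IsUnit (A + Matrix.single 0 0 1)) {w : Fin (s + 1) → ℝ} (hw : A *ᵥ w = 0)
    (hw0 : w 0 = 1) (ξ : ℝ) {h : ℝ} (hh : 0 < h) :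
    HasDoubleEigenvalueAtInfinity (fun ω => Dnum A ξ ω h) (w (Fin.last s)) := by
  obtain ⟨C, hC, H⟩ := eventually_stage_bound hrow hunit hw hw0 ξ hh
  set r := w (Fin.last s) with hr
  have key : ∀ᶠ ω in atTop, |Dnum A ξ ω h 0 0 - r| ≤ C / ω ∧ |Dnum A ξ ω h 1 0| ≤ C ∧
      |Dnum A ξ ω h 0 1| ≤ C / ω ∧ |Dnum A ξ ω h 1 1 - r| ≤ C / ω := by
    filter_upwards [H, eventually_isUnit_stageMatrix_atTop hrow hunit hw hw0 ξ hh,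
      eventually_ge_atTop 1] with ω H hS hω
    have hω0 : 0 < ω := by linarith
    have col : ∀ u v : ℝ, ∃ V W : Fin (s + 1) → ℝ, stageMatrix A ξ ω h *ᵥ Sum.elim V W =
        Sum.elim (fun _ => -ω ^ 2 * u) (fun _ => v) := by
      intro u v
      obtain ⟨x, hx⟩ := Matrix.mulVec_surjective_iff_isUnit.2 hS
        (Sum.elim (fun _ => -ω ^ 2 * u) (fun _ => v))
      exact ⟨x ∘ Sum.inl, x ∘ Sum.inr, by rw [Sum.elim_comp_inl_inr]; exact hx⟩
    -- This rewrites the velocity increment h(AW)_s as V_s - v, the quantity controlled by the stage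
    -- bound.
    have hlast : ∀ (u v : ℝ) (V W : Fin (s + 1) → ℝ), stageMatrix A ξ ω h *ᵥ Sum.elim V W =
        Sum.elim (fun _ => -ω ^ 2 * u) (fun _ => v) → ∀ i, V i = v + h * (A *ᵥ W) i := by
      intro u v V W hVW i
      rw [stageMatrix_mulVec] at hVW
      have := congrFun hVW (Sum.inr i)
      simp only [Sum.elim_inr, Pi.sub_apply, Pi.smul_apply, smul_eq_mul] at this
      linarith
    obtain ⟨V, W, hVW⟩ := col 1 0
    obtain ⟨V', W', hVW'⟩ := col 0 1
    have b := H _ _ _ _ hVW (Fin.last s)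
    have b' := H _ _ _ _ hVW' (Fin.last s)
    have l := hlast _ _ _ _ hVW (Fin.last s)
    have l' := hlast _ _ _ _ hVW' (Fin.last s)
    have e0 := update_mul_inv_mulVec hS hVW
    have e1 := update_mul_inv_mulVec hS hVW'
    simp only [Dnum_apply, inputMatrix_col_zero, inputMatrix_col_one]
    simp only [mul_one] at e0
    simp only [mul_zero] at e1
    rw [e0, e1]
    have hC' : C * ω⁻¹ / ω ≤ C / ω := by
      gcongr
      exact mul_le_of_le_one_right hC.le (inv_le_one_of_one_le₀ hω)
    rw [l] at b
    rw [l'] at b'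
    have hmax : max 0 ω⁻¹ = ω⁻¹ := max_eq_right (by positivity)
    simp [abs_of_pos hω0, hmax] at b b' ⊢
    refine ⟨b.1, b.2, b'.1.trans hC', ?_⟩
    rw [div_eq_mul_inv]
    exact b'.2
  have hdiv : Tendsto (fun ω : ℝ => C / ω) atTop (𝓝 0) := tendsto_const_nhds.div_atTop tendsto_id
  have t00 : Tendsto (fun ω => Dnum A ξ ω h 0 0) atTop (𝓝 r) := by
    rw [tendsto_iff_norm_sub_tendsto_zero]
    exact squeeze_zero' (Eventually.of_forall fun _ => norm_nonneg _)
      (key.mono fun _ hk => hk.1) hdiv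
  have t11 : Tendsto (fun ω => Dnum A ξ ω h 1 1) atTop (𝓝 r) := by
    rw [tendsto_iff_norm_sub_tendsto_zero]
    exact squeeze_zero' (Eventually.of_forall fun _ => norm_nonneg _)
      (key.mono fun _ hk => hk.2.2.2) hdiv
  -- The lower left entry is only known to be bounded, so convergence of the matrix itself is not
  -- claimed; the O(1/ω) upper right entry makes the product vanish, which is enough for the
  -- determinant.
  have tp : Tendsto (fun ω => Dnum A ξ ω h 0 1 * Dnum A ξ ω h 1 0) atTop (𝓝 0) := by
    have h2 : Tendsto (fun ω : ℝ => C / ω * C) atTop (𝓝 0) := by simpa using hdiv.mul_const C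
    refine squeeze_zero_norm' (key.mono fun ω hk => ?_) h2
    rw [norm_mul]
    exact mul_le_mul hk.2.2.1 hk.2.1 (norm_nonneg _) ((abs_nonneg _).trans hk.2.2.1)
  have ttr : Tendsto (fun ω => (Dnum A ξ ω h).trace) atTop (𝓝 (2 * r)) := by
    simp only [Matrix.trace_fin_two]
    rw [two_mul]
    exact t00.add t11
  have tdet : Tendsto (fun ω => (Dnum A ξ ω h).det) atTop (𝓝 (r ^ 2)) := by
    simp only [Matrix.det_fin_two]
    have := (t00.mul t11).sub tp
    rwa [sub_zero, ← sq] at this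
  intro k
  have hpoly : (Polynomial.X - Polynomial.C r) ^ 2 = Polynomial.X ^ 2 -
      Polynomial.C (2 * r) * Polynomial.X + Polynomial.C (r ^ 2) * 1 := by
    simp only [map_mul, map_pow, Polynomial.C_ofNat]
    ring
  rw [hpoly]
  have hchar : ∀ D : Matrix (Fin 2) (Fin 2) ℝ, D.charpoly = Polynomial.X ^ 2 -
      Polynomial.C D.trace * Polynomial.X + Polynomial.C D.det * 1 := fun D => by
    rw [Matrix.charpoly_fin_two, mul_one]
  simp only [hchar, Polynomial.coeff_add, Polynomial.coeff_sub, Polynomial.coeff_C_mul]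
  exact (tendsto_const_nhds.sub (ttr.mul_const _)).add (tdet.mul_const _)

end HighFrequency

/-! ### Kernel vectors of lower triangular coefficient matrices. -/

section Triangular

variable {s : ℕ} {A : Matrix (Fin (s + 1)) (Fin (s + 1)) ℝ} {μ : ℝ}

theorem isUnit_add_single (hA : A.IsLowerTriangular) (hrow : ∀ j, A 0 j = 0)
    (hdiag : ∀ i, i ≠ 0 → A i i = μ) (hμ : μ ≠ 0) : IsUnit (A + Matrix.single 0 0 1) := by
  rw [Matrix.isUnit_iff_isUnit_det, Matrix.det_of_isLowerTriangular, isUnit_iff_ne_zero,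
    Finset.prod_ne_zero_iff]
  · intro i _
    rw [Matrix.add_apply, Matrix.single_apply]
    by_cases hi : i = 0
    · simp [hi, hrow]
    · simp [hdiag i hi, hμ, Ne.symm hi]
  · intro i j hij
    have hij' : i < j := hij
    rw [Matrix.add_apply, hA hij, Matrix.single_apply, if_neg, add_zero]
    rintro ⟨rfl, rfl⟩
    exact lt_irrefl _ hij'

/-- Cayley–Hamilton for the characteristic polynomial X(X - μ)^s. It places (A - μ)^s 1 in the
kernel of A. -/
theorem mul_sub_pow_eq_zero (hA : A.IsLowerTriangular) (hrow : ∀ j, A 0 j = 0)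
    (hdiag : ∀ i, i ≠ 0 → A i i = μ) : A * (A - μ • 1) ^ s = 0 := by
  have h1 : A.charpoly = Polynomial.X * (Polynomial.X - Polynomial.C μ) ^ s := by
    rw [← Matrix.charpoly_transpose,
      Matrix.charpoly_of_isUpperTriangular Aᵀ hA.transpose, Fin.prod_univ_succ]
    simp [hrow, hdiag]
  have h2 := Matrix.aeval_self_charpoly A
  rw [h1] at h2
  simpa [Algebra.algebraMap_eq_smul_one] using h2

theorem sub_pow_mulVec_zero (hrow : ∀ j, A 0 j = 0) (x : Fin (s + 1) → ℝ) (n : ℕ) :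
    ((A - μ • 1) ^ n *ᵥ x) 0 = (-μ) ^ n * x 0 := by
  induction n with
  | zero => simp
  | succ n ih =>
    have : ((A - μ • 1) *ᵥ ((A - μ • 1) ^ n *ᵥ x)) 0 = -μ * ((A - μ • 1) ^ n *ᵥ x) 0 := by
      rw [Matrix.sub_mulVec, Matrix.smul_mulVec, Matrix.one_mulVec, Pi.sub_apply, Pi.smul_apply]
      simp [Matrix.mulVec, dotProduct, hrow]
    rw [pow_succ', ← Matrix.mulVec_mulVec, this, ih]
    ring

/-- Binomial expansion, with the order conditions for l = 0 giving (A^k 1)_s = 1/k! up to k = p. -/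
theorem sub_pow_mulVec_last {γ : Fin (s + 1) → ℝ} {p : ℕ} (h : LinearOrderConditions A γ p)
    {n : ℕ} (hn : n ≤ p) :
    ((A - μ • 1) ^ n *ᵥ fun _ => 1) (Fin.last s) =
      ∑ k ∈ Finset.range (n + 1), (-μ) ^ (n - k) * n.choose k / k.factorial := by
  have h1 : ∀ k ≤ p, (A ^ k *ᵥ fun _ => 1) (Fin.last s) = 1 / k.factorial := by
    intro k hk
    rcases k with _ | k
    · simp
    · simpa using h k 0 (by omega)
  have hc : Commute A (-(μ • (1 : Matrix (Fin (s + 1)) (Fin (s + 1)) ℝ))) :=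
    ((Commute.one_right A).smul_right μ).neg_right
  rw [sub_eq_add_neg, hc.add_pow, Matrix.sum_mulVec, Finset.sum_apply]
  refine Finset.sum_congr rfl fun k hk => ?_
  have hk' : k ≤ p := by have := Finset.mem_range.1 hk; omega
  have e : A ^ k * (-(μ • (1 : Matrix (Fin (s + 1)) (Fin (s + 1)) ℝ))) ^ (n - k) *
      ((n.choose k : ℕ) : Matrix (Fin (s + 1)) (Fin (s + 1)) ℝ) =
      ((-μ) ^ (n - k) * n.choose k) • A ^ k := by
    rw [← neg_smul, smul_pow, one_pow, mul_smul_comm, mul_one, ← nsmul_eq_mul', smul_comm,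
      ← Nat.cast_smul_eq_nsmul ℝ, smul_smul, mul_comm]
  rw [e, Matrix.smul_mulVec, Pi.smul_apply, h1 k hk', smul_eq_mul]
  ring

end Triangular

end

end SubStep

/-! ### Order conditions for the six-sub-step coefficients. -/

namespace SUCI6

noncomputable section

variable {γ : Fin 7 → ℝ}

theorem Admissible.ne_zero (h : Admissible γ) {i : Fin 7} (hi : i ≠ 0) (hi6 : i ≠ 6) :
    γ i ≠ 0 := by
  rw [← h.zero]
  exact h.distinct i 0 hi6 (by decide) hi

theorem Admissible.sub_ne_zero (h : Admissible γ) {i j : Fin 7} (hi : i ≠ 6) (hj : j ≠ 6)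
    (hij : i ≠ j) : γ i - γ j ≠ 0 :=
  _root_.sub_ne_zero.2 (h.distinct i j hi hj hij)

/-! The moments of the strictly lower triangular part of the coefficient matrix: the sums over
`6 > i₁ > ⋯ > iₘ` of products of coefficients times `γ (γ - γ 1) ⋯ (γ - γ k)` at `iₘ`. -/

/-- The right-hand sides of the moments come from expanding (A - γ₁/2)^m and inserting the required
values l!/(m+l)! of (A^m γ^l)₆. Here only node 5 survives in the strict part, so the identity is the
defining equation of `a65`. -/
theorem moment_one_four (h : Admissible γ) :
    a65 γ * (γ 5 * (γ 5 - γ 1) * (γ 5 - γ 2) * (γ 5 - γ 3) * (γ 5 - γ 4)) =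
      (1 / 6 - (γ 1 + γ 2 + γ 3 + γ 4) / 5 +
        (γ 1 * γ 2 + γ 1 * γ 3 + γ 1 * γ 4 + γ 2 * γ 3 + γ 2 * γ 4 + γ 3 * γ 4) / 4 -
        (γ 1 * γ 2 * γ 3 + γ 1 * γ 2 * γ 4 + γ 1 * γ 3 * γ 4 + γ 2 * γ 3 * γ 4) / 3 +
        γ 1 * γ 2 * γ 3 * γ 4 / 2) -
      γ 1 / 2 * ((1 - γ 1) * (1 - γ 2) * (1 - γ 3) * (1 - γ 4)) := by
  have hd : 60 * γ 5 * (γ 4 - γ 5) * (γ 3 - γ 5) * (γ 2 - γ 5) * (γ 1 - γ 5) ≠ 0 := by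
    refine mul_ne_zero (mul_ne_zero (mul_ne_zero (mul_ne_zero (mul_ne_zero (by norm_num) ?_)
      ?_) ?_) ?_) ?_
    · exact h.ne_zero (by decide) (by decide)
    all_goals exact h.sub_ne_zero (by decide) (by decide) (by decide)
  have e := div_mul_cancel₀ (30 * (1 - γ 4) * (γ 3 - 1) * (γ 2 - 1) * γ 1^2 +
    (45 - 50 * γ 4 + 10 * γ 3 * (6 * γ 4 - 5)) * γ 1 * γ 2 + 3 * γ 3 * (5 * γ 4 - 4) +
    (45 * γ 4 - 42 + 5 * γ 3 * (9 - 10 * γ 4)) * γ 1 +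
    (15 * γ 4 - 12 + 5 * γ 3 * (3 - 4 * γ 4)) * γ 2 - 12 * γ 4 + 10) hd
  rw [← a65] at e
  linear_combination e / 60

theorem moment_one_three (h : Admissible γ) :
    a64 γ * (γ 4 * (γ 4 - γ 1) * (γ 4 - γ 2) * (γ 4 - γ 3)) +
      a65 γ * (γ 5 * (γ 5 - γ 1) * (γ 5 - γ 2) * (γ 5 - γ 3)) =
      (1 / 5 - (γ 1 + γ 2 + γ 3) / 4 + (γ 1 * γ 2 + γ 1 * γ 3 + γ 2 * γ 3) / 3 -
        γ 1 * γ 2 * γ 3 / 2) - γ 1 / 2 * ((1 - γ 1) * (1 - γ 2) * (1 - γ 3)) := by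
  have hd : 60 * γ 4 * (γ 3 - γ 4) * (γ 2 - γ 4) * (γ 1 - γ 4) ≠ 0 := by
    refine mul_ne_zero (mul_ne_zero (mul_ne_zero (mul_ne_zero (by norm_num) ?_) ?_) ?_) ?_
    · exact h.ne_zero (by decide) (by decide)
    all_goals exact h.sub_ne_zero (by decide) (by decide) (by decide)
  have e := div_mul_cancel₀ (30 * (1 - γ 3) * (γ 2 - 1) * γ 1^2 + (45 - 50 * γ 3 +
    10 * γ 2 * (6 * γ 3 - 5) - 60 * a65 γ * γ 5 * (γ 3 - γ 5) * (γ 2 - γ 5)) * γ 1 +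
    (15 - 20 * γ 3 + 60 * a65 γ * γ 5^2 * (γ 3 - γ 5)) * γ 2 -
    60 * a65 γ * γ 5^3 * (γ 3 - γ 5) + 15 * γ 3 - 12) hd
  rw [← a64] at e
  linear_combination -e / 60

theorem moment_two_three (h : Admissible γ) :
    a65 γ * a54 γ * (γ 4 * (γ 4 - γ 1) * (γ 4 - γ 2) * (γ 4 - γ 3)) =
      (1 / 30 - (γ 1 + γ 2 + γ 3) / 20 + (γ 1 * γ 2 + γ 1 * γ 3 + γ 2 * γ 3) / 12 -
        γ 1 * γ 2 * γ 3 / 6) -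
      γ 1 * (1 / 5 - (γ 1 + γ 2 + γ 3) / 4 + (γ 1 * γ 2 + γ 1 * γ 3 + γ 2 * γ 3) / 3 -
        γ 1 * γ 2 * γ 3 / 2) + γ 1 ^ 2 / 4 * ((1 - γ 1) * (1 - γ 2) * (1 - γ 3)) := by
  have hd : 60 * a65 γ * γ 4 * (γ 3 - γ 4) * (γ 2 - γ 4) * (γ 1 - γ 4) ≠ 0 := by
    refine mul_ne_zero (mul_ne_zero (mul_ne_zero (mul_ne_zero (mul_ne_zero (by norm_num)
      h.h65) ?_) ?_) ?_) ?_
    · exact h.ne_zero (by decide) (by decide)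
    all_goals exact h.sub_ne_zero (by decide) (by decide) (by decide)
  have e := div_mul_cancel₀ (15 * (γ 3 - 1) * (γ 2 - 1) * γ 1^3 + (35 * γ 3 - 30 +
    5 * γ 2 * (7 - 9 * γ 3)) * γ 1^2 + (15 - 20 * γ 3 + 10 * γ 2 * (3 * γ 3 - 2)) * γ 1 +
    (3 - 5 * γ 3) * γ 2 + 3 * γ 3 - 2) hd
  rw [← a54] at e
  linear_combination -e / 60

theorem moment_one_two (h : Admissible γ) :
    a63 γ * (γ 3 * (γ 3 - γ 1) * (γ 3 - γ 2)) + a64 γ * (γ 4 * (γ 4 - γ 1) * (γ 4 - γ 2)) +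
      a65 γ * (γ 5 * (γ 5 - γ 1) * (γ 5 - γ 2)) =
      (1 / 4 - (γ 1 + γ 2) / 3 + γ 1 * γ 2 / 2) - γ 1 / 2 * ((1 - γ 1) * (1 - γ 2)) := by
  have hd : 12 * γ 3 * (γ 2 - γ 3) * (γ 1 - γ 3) ≠ 0 := by
    refine mul_ne_zero (mul_ne_zero (mul_ne_zero (by norm_num) ?_) ?_) ?_
    · exact h.ne_zero (by decide) (by decide)
    all_goals exact h.sub_ne_zero (by decide) (by decide) (by decide)
  have e := div_mul_cancel₀ (12 * a64 γ * γ 4 * (γ 2 - γ 4) * (γ 4 - γ 1) +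
    12 * a65 γ * γ 5 * (γ 2 - γ 5) * (γ 5 - γ 1) - 6 * γ 1 * (γ 1 * (γ 2 - 1) - 2 * γ 2) -
    10 * γ 1 - 4 * γ 2 + 3) hd
  rw [← a63] at e
  linear_combination e / 12

/-- This is the defining equation of `a43`. Full admissibility is not assumed, because this identity
and `moment_three_two` serve to prove `a43 γ ≠ 0` for the default ratios. -/
theorem moment_two_two (h0 : γ 0 = 0)
    (hγ : ∀ i j : Fin 7, i ≠ 6 → j ≠ 6 → i ≠ j → γ i ≠ γ j) (h64 : a64 γ ≠ 0) :
    a64 γ * a43 γ * (γ 3 * (γ 3 - γ 1) * (γ 3 - γ 2)) +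
      a65 γ * (a53 γ * (γ 3 * (γ 3 - γ 1) * (γ 3 - γ 2)) +
        a54 γ * (γ 4 * (γ 4 - γ 1) * (γ 4 - γ 2))) =
      (1 / 20 - (γ 1 + γ 2) / 12 + γ 1 * γ 2 / 6) -
      γ 1 * (1 / 4 - (γ 1 + γ 2) / 3 + γ 1 * γ 2 / 2) +
      γ 1 ^ 2 / 4 * ((1 - γ 1) * (1 - γ 2)) := by
  have hd : 60 * a64 γ * γ 3 * (γ 2 - γ 3) * (γ 1 - γ 3) ≠ 0 := by
    refine mul_ne_zero (mul_ne_zero (mul_ne_zero (mul_ne_zero (by norm_num) h64) ?_) ?_) ?_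
    · exact h0 ▸ hγ 3 0 (by decide) (by decide) (by decide)
    all_goals exact sub_ne_zero.2 (hγ _ _ (by decide) (by decide) (by decide))
  have e := div_mul_cancel₀ (60 * a65 γ * a53 γ * γ 3 * (γ 2 - γ 3) * (γ 3 - γ 1) +
    60 * a65 γ * a54 γ * γ 4 * (γ 2 - γ 4) * (γ 4 - γ 1) +
    5 * γ 1^2 * (3 * γ 1 * γ 2 - 3 * γ 1 - 9 * γ 2 + 7) +
    30 * γ 1 * γ 2 - 20 * γ 1 - 5 * γ 2 + 3) hd
  rw [← a43] at e
  linear_combination e / 60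

theorem moment_three_two (h0 : γ 0 = 0)
    (hγ : ∀ i j : Fin 7, i ≠ 6 → j ≠ 6 → i ≠ j → γ i ≠ γ j) (h65 : a65 γ ≠ 0)
    (h64 : a64 γ ≠ 0) (h54 : a54 γ ≠ 0) :
    a65 γ * a54 γ * a43 γ * (γ 3 * (γ 3 - γ 1) * (γ 3 - γ 2)) =
      (1 / 120 - (γ 1 + γ 2) / 60 + γ 1 * γ 2 / 24) -
      3 * γ 1 / 2 * (1 / 20 - (γ 1 + γ 2) / 12 + γ 1 * γ 2 / 6) +
      3 * γ 1 ^ 2 / 4 * (1 / 4 - (γ 1 + γ 2) / 3 + γ 1 * γ 2 / 2) -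
      γ 1 ^ 3 / 8 * ((1 - γ 1) * (1 - γ 2)) := by
  have hd : 240 * a65 γ^2 * a54 γ * γ 3 * (γ 2 - γ 3) * (γ 1 - γ 3) ≠ 0 := by
    refine mul_ne_zero (mul_ne_zero (mul_ne_zero (mul_ne_zero (mul_ne_zero (by norm_num)
      (pow_ne_zero _ h65)) h54) ?_) ?_) ?_
    · exact h0 ▸ hγ 3 0 (by decide) (by decide) (by decide)
    all_goals exact sub_ne_zero.2 (hγ _ _ (by decide) (by decide) (by decide))
  have e := div_mul_cancel₀ (240 * a65 γ^2 * a54 γ^2 * γ 4 * (γ 2 - γ 4) * (γ 4 - γ 1) +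
    30 * a64 γ * γ 1^4 * (γ 2 - 1) + (60 * a65 γ * a54 γ * (γ 2 - 1) +
    30 * a64 γ * (3 - 4 * γ 2)) * γ 1^3 +
    (20 * a65 γ * a54 γ * (7 - 9 * γ 2) + 15 * a64 γ * (8 * γ 2 - 5)) * γ 1^2 +
    (40 * a65 γ * a54 γ * (3 * γ 2 - 2) + 2 * a64 γ * (11 - 20 * γ 2)) * γ 1 +
    4 * a65 γ * a54 γ * (3 - 5 * γ 2) + 2 * a64 γ * (2 * γ 2 - 1)) hd
  rw [← a53] at e
  -- The formula for `a53` results from eliminating `a43` between the moments (2,2) and (3,2); the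
  -- factor `a64` undoes this elimination.
  refine mul_left_cancel₀ h64 ?_
  linear_combination a65 γ * a54 γ * moment_two_two h0 hγ h64 - e / 240

theorem moment_one_one (h : Admissible γ) :
    a62 γ * (γ 2 * (γ 2 - γ 1)) + a63 γ * (γ 3 * (γ 3 - γ 1)) + a64 γ * (γ 4 * (γ 4 - γ 1)) +
      a65 γ * (γ 5 * (γ 5 - γ 1)) = (1 / 3 - γ 1 / 2) - γ 1 / 2 * (1 - γ 1) := by
  have hd : 6 * γ 2 * (γ 2 - γ 1) ≠ 0 := by
    refine mul_ne_zero (mul_ne_zero (by norm_num) ?_) ?_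
    · exact h.ne_zero (by decide) (by decide)
    · exact h.sub_ne_zero (by decide) (by decide) (by decide)
  have e := div_mul_cancel₀ (6 * a63 γ * γ 3 * (γ 1 - γ 3) + 6 * a64 γ * γ 4 * (γ 1 - γ 4) +
    6 * a65 γ * γ 5 * (γ 1 - γ 5) + 3 * γ 1^2 - 6 * γ 1 + 2) hd
  rw [← a62] at e
  linear_combination e / 6

theorem moment_four_one (h : Admissible γ) :
    a65 γ * a54 γ * a43 γ * a32 γ * (γ 2 * (γ 2 - γ 1)) =
      (1 / 360 - γ 1 / 120) - 2 * γ 1 * (1 / 60 - γ 1 / 24) +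
      3 * γ 1 ^ 2 / 2 * (1 / 12 - γ 1 / 6) - γ 1 ^ 3 / 2 * (1 / 3 - γ 1 / 2) +
      γ 1 ^ 4 / 16 * (1 - γ 1) := by
  have hd : 720 * a65 γ * a54 γ * a43 γ * γ 2 * (γ 1 - γ 2) ≠ 0 := by
    refine mul_ne_zero (mul_ne_zero (mul_ne_zero (mul_ne_zero (mul_ne_zero (by norm_num)
      h.h65) h.h54) h.h43) ?_) ?_
    · exact h.ne_zero (by decide) (by decide)
    · exact h.sub_ne_zero (by decide) (by decide) (by decide)
  have e := div_mul_cancel₀ (45 * γ 1^5 - 225 * γ 1^4 + 300 * γ 1^3 - 150 * γ 1^2 +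
    30 * γ 1 - 2) hd
  rw [← a32] at e
  linear_combination -e / 720

theorem a42_mul (h : Admissible γ) :
    a42 γ * (720 * a65 γ^2 * a54 γ^2 * a43 γ * γ 2 * (γ 1 - γ 2)) =
    -45 * (a64 γ * a43 γ + a65 γ * a53 γ) * γ 1^5 + (225 * a64 γ * a43 γ +
    225 * a65 γ * a53 γ - 90 * a65 γ * a54 γ * a43 γ) * γ 1^4 +
    720 * a65 γ^2 * a54 γ^2 * a43 γ^2 * γ 3^2 +
    (360 * a65 γ * a54 γ * a43 γ - 300 * a64 γ * a43 γ - 300 * a65 γ * a53 γ) * γ 1^3 +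
    (150 * a64 γ * a43 γ + 150 * a65 γ * a53 γ - 360 * a65 γ * a54 γ * a43 γ) * γ 1^2 +
    (120 * a65 γ * a54 γ * a43 γ - 30 * a64 γ * a43 γ - 30 * a65 γ * a53 γ -
    720 * a65 γ^2 * a54 γ^2 * a43 γ^2 * γ 3) * γ 1 - 12 * a65 γ * a54 γ * a43 γ +
    2 * a64 γ * a43 γ + 2 * a65 γ * a53 γ := by
  refine div_mul_cancel₀ _ ?_
  refine mul_ne_zero (mul_ne_zero (mul_ne_zero (mul_ne_zero (mul_ne_zero (by norm_num)
    (pow_ne_zero _ h.h65)) (pow_ne_zero _ h.h54)) h.h43) ?_) ?_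
  · exact h.ne_zero (by decide) (by decide)
  · exact h.sub_ne_zero (by decide) (by decide) (by decide)

theorem moment_three_one (h : Admissible γ) :
    a65 γ * a54 γ * (a43 γ * (γ 3 * (γ 3 - γ 1)) + a42 γ * (γ 2 * (γ 2 - γ 1))) +
      (a64 γ * a43 γ + a65 γ * a53 γ) * a32 γ * (γ 2 * (γ 2 - γ 1)) =
      (1 / 60 - γ 1 / 24) - 3 * γ 1 / 2 * (1 / 12 - γ 1 / 6) +
      3 * γ 1 ^ 2 / 4 * (1 / 3 - γ 1 / 2) - γ 1 ^ 3 / 8 * (1 - γ 1) := by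
  -- The formula for `a42` already has `a32` eliminated by the moment (4,1); the common factor
  -- permits adding that moment back.
  refine mul_left_cancel₀ (mul_ne_zero (mul_ne_zero h.h65 h.h54) h.h43) ?_
  linear_combination (a64 γ * a43 γ + a65 γ * a53 γ) * moment_four_one h - a42_mul h / 720

theorem moment_two_one (h : Admissible γ) :
    a63 γ * a32 γ * (γ 2 * (γ 2 - γ 1)) +
      a64 γ * (a42 γ * (γ 2 * (γ 2 - γ 1)) + a43 γ * (γ 3 * (γ 3 - γ 1))) +
      a65 γ * (a52 γ * (γ 2 * (γ 2 - γ 1)) + a53 γ * (γ 3 * (γ 3 - γ 1)) +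
        a54 γ * (γ 4 * (γ 4 - γ 1))) =
      (1 / 12 - γ 1 / 6) - γ 1 * (1 / 3 - γ 1 / 2) + γ 1 ^ 2 / 4 * (1 - γ 1) := by
  have hd : 720 * a65 γ^3 * a54 γ^2 * a43 γ * γ 2 * (γ 1 - γ 2) ≠ 0 := by
    refine mul_ne_zero (mul_ne_zero (mul_ne_zero (mul_ne_zero (mul_ne_zero (by norm_num)
      (pow_ne_zero _ h.h65)) (pow_ne_zero _ h.h54)) h.h43) ?_) ?_
    · exact h.ne_zero (by decide) (by decide)
    · exact h.sub_ne_zero (by decide) (by decide) (by decide)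
  have e := div_mul_cancel₀ (45 * (a64 γ^2 * a43 γ + a65 γ * a64 γ * a53 γ -
    a65 γ * a63 γ * a54 γ) * γ 1^5 -
    12 * a65 γ * a54 γ * a43 γ * (5 * a65 γ * a54 γ - a64 γ) + 2 * a65 γ * (a63 γ * a54 γ -
    a64 γ * a53 γ) +
    (90 * a65 γ * a64 γ * a54 γ * a43 γ - 225 * a64 γ^2 * a43 γ -
    225 * a65 γ * a64 γ * a53 γ + 225 * a65 γ * a63 γ * a54 γ) * γ 1^4 +
    720 * a65 γ^3 * a54 γ^2 * a43 γ * (a54 γ * γ 4^2 + a53 γ * γ 3^2) +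
    (180 * a65 γ * a54 γ * a43 γ * (a65 γ * a54 γ - 2 * a64 γ) + 300 * (a64 γ^2 * a43 γ +
    a65 γ * a64 γ * a53 γ - a65 γ * a63 γ * a54 γ)) * γ 1^3 - 2 * a43 γ * a64 γ^2 +
    (180 * a65 γ * a54 γ * a43 γ * (2 * a64 γ - 3 * a65 γ * a54 γ) -
    150 * (a64 γ^2 * a43 γ + a65 γ * a64 γ * a53 γ - a65 γ * a63 γ * a54 γ)) * γ 1^2 +
    (360 * a65 γ^2 * a54 γ^2 * a43 γ * (1 - 2 * a65 γ * (a54 γ * γ 4 + a53 γ * γ 3)) -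
    30 * a64 γ * a43 γ * (4 * a65 γ * a54 γ - a64 γ) + 30 * a65 γ * (a64 γ * a53 γ -
    a63 γ * a54 γ)) * γ 1) hd
  rw [← a52] at e
  refine mul_left_cancel₀ (mul_ne_zero (mul_ne_zero (pow_ne_zero 2 h.h65)
    (pow_ne_zero 2 h.h54)) h.h43) ?_
  linear_combination a63 γ * a65 γ * a54 γ * moment_four_one h - a64 γ * a42_mul h / 720 -
    e / 720

theorem coeffs_mulVec_one (h : Admissible γ) : (coeffs γ *ᵥ fun _ => 1) = γ := by
  have h1 : γ 1 ≠ 0 := h.ne_zero (by decide) (by decide)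
  funext i
  fin_cases i <;>
    simp [coeffs, Matrix.mulVec, dotProduct, Fin.sum_univ_seven, h.zero, h.one, a20, a21, a30,
      a31, a40, a41, a50, a51, a60, a61] <;> field_simp <;> ring

theorem coeffs_mulVec_ratios (h : Admissible γ) :
    coeffs γ *ᵥ γ = (1 / 2 : ℝ) • fun i => γ i ^ 2 := by
  have h1 : γ 1 ≠ 0 := h.ne_zero (by decide) (by decide)
  funext i
  fin_cases i <;>
    simp [coeffs, Matrix.mulVec, dotProduct, Fin.sum_univ_seven, h.zero, h.one, a20, a21, a30,
      a31, a40, a41, a50, a51, a60, a61] <;> field_simp <;> ring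

/-- On vectors vanishing at nodes 0 and 1 the first two columns drop out, so the moments involve
only the ten coefficients α_ij with 2 ≤ j < i and the diagonal. -/
theorem coeffs_mulVec_of_zero (γ : Fin 7 → ℝ) (z₂ z₃ z₄ z₅ z₆ : ℝ) :
    coeffs γ *ᵥ ![0, 0, z₂, z₃, z₄, z₅, z₆] =
      ![0, 0, γ 1 / 2 * z₂, a32 γ * z₂ + γ 1 / 2 * z₃,
        a42 γ * z₂ + a43 γ * z₃ + γ 1 / 2 * z₄,
        a52 γ * z₂ + a53 γ * z₃ + a54 γ * z₄ + γ 1 / 2 * z₅,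
        a62 γ * z₂ + a63 γ * z₃ + a64 γ * z₄ + a65 γ * z₅ + γ 1 / 2 * z₆] := by
  funext i
  fin_cases i <;> simp [coeffs, Matrix.mulVec, dotProduct, Fin.sum_univ_seven]

theorem linearOrderConditions_coeffs (h : Admissible γ) :
    SubStep.LinearOrderConditions (coeffs γ) γ 6 := by
  set A := coeffs γ with hA
  set M : ℕ → ℕ → ℝ := fun m l => (A ^ m *ᵥ fun i => γ i ^ l) 6 with hM
  have r0 : ∀ l, M 0 l = 1 := fun l => by simp [hM, h.one]
  -- A1 = γ and Aγ = γ²/2 express the conditions for l = 0 and l = 1 through those for larger l and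
  -- smaller m.
  have r1 : ∀ m, M (m + 1) 0 = M m 1 := fun m => by
    simp only [hM, pow_zero, pow_one]
    rw [pow_succ, ← Matrix.mulVec_mulVec, hA, coeffs_mulVec_one h]
  have r2 : ∀ m, M (m + 1) 1 = M m 2 / 2 := fun m => by
    simp only [hM, pow_one]
    rw [pow_succ, ← Matrix.mulVec_mulVec, hA, coeffs_mulVec_ratios h, Matrix.mulVec_smul,
      Pi.smul_apply, smul_eq_mul]
    ring
  -- The Newton basis at the nodes: each vector vanishes at one more node than the previous one,
  -- which leaves fewer coefficients in its moments.
  set x₁ : Fin 7 → ℝ := fun i => γ i * (γ i - γ 1) with hx₁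
  set x₂ : Fin 7 → ℝ := fun i => γ i * (γ i - γ 1) * (γ i - γ 2) with hx₂
  set x₃ : Fin 7 → ℝ := fun i => γ i * (γ i - γ 1) * (γ i - γ 2) * (γ i - γ 3) with hx₃
  set x₄ : Fin 7 → ℝ :=
    fun i => γ i * (γ i - γ 1) * (γ i - γ 2) * (γ i - γ 3) * (γ i - γ 4) with hx₄
  have v₁ : x₁ = ![0, 0, x₁ 2, x₁ 3, x₁ 4, x₁ 5, x₁ 6] := by
    funext i; fin_cases i <;> simp [hx₁, h.zero]
  have v₂ : x₂ = ![0, 0, 0, x₂ 3, x₂ 4, x₂ 5, x₂ 6] := by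
    funext i; fin_cases i <;> simp [hx₂, h.zero]
  have v₃ : x₃ = ![0, 0, 0, 0, x₃ 4, x₃ 5, x₃ 6] := by
    funext i; fin_cases i <;> simp [hx₃, h.zero]
  have v₄ : x₄ = ![0, 0, 0, 0, 0, x₄ 5, x₄ 6] := by
    funext i; fin_cases i <;> simp [hx₄, h.zero]
  have s₁ : ∀ m, (A ^ m *ᵥ x₁) 6 = M m 2 - γ 1 * M m 1 := fun m => by
    have : x₁ = (fun i => γ i ^ 2) - γ 1 • fun i => γ i ^ 1 := by
      funext i; simp [hx₁]; ring
    simp [this, hM, Matrix.mulVec_sub, Matrix.mulVec_smul]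
  have s₂ : ∀ m, (A ^ m *ᵥ x₂) 6 = M m 3 - (γ 1 + γ 2) * M m 2 + γ 1 * γ 2 * M m 1 :=
    fun m => by
    have : x₂ = (fun i => γ i ^ 3) - (γ 1 + γ 2) • (fun i => γ i ^ 2) +
        (γ 1 * γ 2) • fun i => γ i ^ 1 := by
      funext i; simp [hx₂]; ring
    simp [this, hM, Matrix.mulVec_sub, Matrix.mulVec_add, Matrix.mulVec_smul]
  have s₃ : ∀ m, (A ^ m *ᵥ x₃) 6 = M m 4 - (γ 1 + γ 2 + γ 3) * M m 3 +
      (γ 1 * γ 2 + γ 1 * γ 3 + γ 2 * γ 3) * M m 2 - γ 1 * γ 2 * γ 3 * M m 1 := fun m => by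
    have : x₃ = (fun i => γ i ^ 4) - (γ 1 + γ 2 + γ 3) • (fun i => γ i ^ 3) +
        (γ 1 * γ 2 + γ 1 * γ 3 + γ 2 * γ 3) • (fun i => γ i ^ 2) -
        (γ 1 * γ 2 * γ 3) • fun i => γ i ^ 1 := by
      funext i; simp [hx₃]; ring
    simp [this, hM, Matrix.mulVec_sub, Matrix.mulVec_add, Matrix.mulVec_smul]
  have s₄ : ∀ m, (A ^ m *ᵥ x₄) 6 = M m 5 - (γ 1 + γ 2 + γ 3 + γ 4) * M m 4 +
      (γ 1 * γ 2 + γ 1 * γ 3 + γ 1 * γ 4 + γ 2 * γ 3 + γ 2 * γ 4 + γ 3 * γ 4) * M m 3 -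
      (γ 1 * γ 2 * γ 3 + γ 1 * γ 2 * γ 4 + γ 1 * γ 3 * γ 4 + γ 2 * γ 3 * γ 4) * M m 2 +
      γ 1 * γ 2 * γ 3 * γ 4 * M m 1 := fun m => by
    have : x₄ = (fun i => γ i ^ 5) - (γ 1 + γ 2 + γ 3 + γ 4) • (fun i => γ i ^ 4) +
        (γ 1 * γ 2 + γ 1 * γ 3 + γ 1 * γ 4 + γ 2 * γ 3 + γ 2 * γ 4 + γ 3 * γ 4) •
          (fun i => γ i ^ 3) -
        (γ 1 * γ 2 * γ 3 + γ 1 * γ 2 * γ 4 + γ 1 * γ 3 * γ 4 + γ 2 * γ 3 * γ 4) •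
          (fun i => γ i ^ 2) + (γ 1 * γ 2 * γ 3 * γ 4) • fun i => γ i ^ 1 := by
      funext i; simp [hx₄]; ring
    simp [this, hM, Matrix.mulVec_sub, Matrix.mulVec_add, Matrix.mulVec_smul]
  have p1 : ∀ z : Fin 7 → ℝ, A ^ 1 *ᵥ z = A *ᵥ z := fun z => by rw [pow_one]
  have p2 : ∀ z : Fin 7 → ℝ, A ^ 2 *ᵥ z = A *ᵥ A *ᵥ z := fun z => by
    rw [pow_two, Matrix.mulVec_mulVec]
  have p3 : ∀ z : Fin 7 → ℝ, A ^ 3 *ᵥ z = A *ᵥ A *ᵥ A *ᵥ z := fun z => by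
    rw [pow_succ', ← Matrix.mulVec_mulVec, p2]
  have p4 : ∀ z : Fin 7 → ℝ, A ^ 4 *ᵥ z = A *ᵥ A *ᵥ A *ᵥ A *ᵥ z := fun z => by
    rw [pow_succ', ← Matrix.mulVec_mulVec, p3]
  have q : ∀ a b c d e f g : ℝ, ![a, b, c, d, e, f, g] 6 = g := fun _ _ _ _ _ _ _ => rfl
  have m11 := moment_one_one h
  have m12 := moment_one_two h
  have m13 := moment_one_three h
  have m14 := moment_one_four h
  have m21 := moment_two_one h
  have m22 := moment_two_two h.zero h.distinct h.h64
  have m23 := moment_two_three h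
  have m31 := moment_three_one h
  have m32 := moment_three_two h.zero h.distinct h.h65 h.h64 h.h54
  have m41 := moment_four_one h
  have M10 : M 1 0 = 1 := by rw [r1, r0]
  have M11 : M 1 1 = 1 / 2 := by rw [r2, r0]
  have M12 : M 1 2 = 1 / 3 := by
    have e := s₁ 1
    rw [p1, v₁, hA, coeffs_mulVec_of_zero, q, M11] at e
    simp only [hx₁, h.one] at e
    linear_combination m11 - e
  have M13 : M 1 3 = 1 / 4 := by
    have e := s₂ 1
    rw [p1, v₂, hA, coeffs_mulVec_of_zero, q, M11, M12] at e
    simp only [hx₂, h.one] at e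
    linear_combination m12 - e
  have M14 : M 1 4 = 1 / 5 := by
    have e := s₃ 1
    rw [p1, v₃, hA, coeffs_mulVec_of_zero, q, M11, M12, M13] at e
    simp only [hx₃, h.one] at e
    linear_combination m13 - e
  have M15 : M 1 5 = 1 / 6 := by
    have e := s₄ 1
    rw [p1, v₄, hA, coeffs_mulVec_of_zero, q, M11, M12, M13, M14] at e
    simp only [hx₄, h.one] at e
    linear_combination m14 - e
  have M20 : M 2 0 = 1 / 2 := by rw [r1, M11]
  have M21 : M 2 1 = 1 / 6 := by rw [r2, M12]; norm_num
  have M22 : M 2 2 = 1 / 12 := by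
    have e := s₁ 2
    rw [p2, v₁, hA, coeffs_mulVec_of_zero, coeffs_mulVec_of_zero, q, M21] at e
    simp only [hx₁, h.one] at e
    -- The weights here and below are the binomial coefficients of (γ₁/2 + N)^m, where N is the
    -- strictly lower triangular part.
    linear_combination m21 + γ 1 * m11 - e
  have M23 : M 2 3 = 1 / 20 := by
    have e := s₂ 2
    rw [p2, v₂, hA, coeffs_mulVec_of_zero, coeffs_mulVec_of_zero, q, M21, M22] at e
    simp only [hx₂, h.one] at e
    linear_combination m22 + γ 1 * m12 - e
  have M24 : M 2 4 = 1 / 30 := by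
    have e := s₃ 2
    rw [p2, v₃, hA, coeffs_mulVec_of_zero, coeffs_mulVec_of_zero, q, M21, M22, M23] at e
    simp only [hx₃, h.one] at e
    linear_combination m23 + γ 1 * m13 - e
  have M30 : M 3 0 = 1 / 6 := by rw [r1, M21]
  have M31 : M 3 1 = 1 / 24 := by rw [r2, M22]; norm_num
  have M32 : M 3 2 = 1 / 60 := by
    have e := s₁ 3
    rw [p3, v₁, hA, coeffs_mulVec_of_zero, coeffs_mulVec_of_zero, coeffs_mulVec_of_zero, q,
      M31] at e
    simp only [hx₁, h.one] at e
    linear_combination m31 + 3 * γ 1 / 2 * m21 + 3 * γ 1 ^ 2 / 4 * m11 - e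
  have M33 : M 3 3 = 1 / 120 := by
    have e := s₂ 3
    rw [p3, v₂, hA, coeffs_mulVec_of_zero, coeffs_mulVec_of_zero, coeffs_mulVec_of_zero, q,
      M31, M32] at e
    simp only [hx₂, h.one] at e
    linear_combination m32 + 3 * γ 1 / 2 * m22 + 3 * γ 1 ^ 2 / 4 * m12 - e
  have M40 : M 4 0 = 1 / 24 := by rw [r1, M31]
  have M41 : M 4 1 = 1 / 120 := by rw [r2, M32]; norm_num
  have M42 : M 4 2 = 1 / 360 := by
    have e := s₁ 4
    rw [p4, v₁, hA, coeffs_mulVec_of_zero, coeffs_mulVec_of_zero, coeffs_mulVec_of_zero,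
      coeffs_mulVec_of_zero, q, M41] at e
    simp only [hx₁, h.one] at e
    linear_combination m41 + 2 * γ 1 * m31 + 3 * γ 1 ^ 2 / 2 * m21 + γ 1 ^ 3 / 2 * m11 - e
  have M50 : M 5 0 = 1 / 120 := by rw [r1, M41]
  have M51 : M 5 1 = 1 / 720 := by rw [r2, M42]; norm_num
  have M60 : M 6 0 = 1 / 720 := by rw [r1, M51]
  intro m l hml
  change M (m + 1) l = _
  have hm : m < 6 := by omega
  have hl : l < 6 := by omega
  interval_cases m <;> interval_cases l <;> first
    | omega
    | (simp only [zero_add, Nat.reduceAdd, M10, M11, M12, M13, M14, M15, M20, M21, M22, M23, M24,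
        M30, M31, M32, M33, M40, M41, M42, M50, M51, M60]
       norm_num [Nat.factorial])

/-! ### The kernel vector and the high-frequency eigenvalue. -/

theorem isLowerTriangular_coeffs (γ : Fin 7 → ℝ) : (coeffs γ).IsLowerTriangular := by
  intro i j hij
  have hij' : i < j := hij
  fin_cases i <;> fin_cases j <;> first
    | rfl
    | exact absurd hij' (by decide)

theorem coeffs_zero (γ : Fin 7 → ℝ) (j : Fin 7) : coeffs γ 0 j = 0 := by
  fin_cases j <;> rfl

theorem coeffs_diag (γ : Fin 7 → ℝ) (i : Fin 7) (hi : i ≠ 0) : coeffs γ i i = γ 1 / 2 := by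
  fin_cases i <;> first
    | rfl
    | exact absurd rfl hi

theorem exists_kernel_vector (h : Admissible γ) :
    ∃ w : Fin 7 → ℝ, coeffs γ *ᵥ w = 0 ∧ w 0 = 1 ∧ w (Fin.last 6) = rhoInf (γ 1) := by
  have h1 : γ 1 ≠ 0 := h.ne_zero (by decide) (by decide)
  -- The factor normalises the zeroth entry: the zeroth entry of (A - μ)⁶1 is (-μ)⁶ = μ⁶.
  refine ⟨((γ 1 / 2) ^ 6)⁻¹ • ((coeffs γ - (γ 1 / 2) • 1) ^ 6 *ᵥ fun _ => 1), ?_, ?_, ?_⟩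
  · rw [Matrix.mulVec_smul, Matrix.mulVec_mulVec, SubStep.mul_sub_pow_eq_zero
      (isLowerTriangular_coeffs γ) (coeffs_zero γ) (coeffs_diag γ), Matrix.zero_mulVec, smul_zero]
  · rw [Pi.smul_apply, SubStep.sub_pow_mulVec_zero (coeffs_zero γ), smul_eq_mul, mul_one,
      (show Even 6 by decide).neg_pow]
    exact inv_mul_cancel₀ (by positivity)
  · rw [Pi.smul_apply, SubStep.sub_pow_mulVec_last (linearOrderConditions_coeffs h) le_rfl]
    simp [Finset.sum_range_succ, Nat.factorial, Nat.choose, rhoInf]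
    field_simp
    ring

theorem eventually_isUnit_stageMatrix_coeffs (h : Admissible γ) (ξ : ℝ) {k : ℝ} (hk : 0 < k) :
    ∀ᶠ ω in atTop, IsUnit (SubStep.stageMatrix (coeffs γ) ξ ω k) := by
  obtain ⟨w, hw, hw0, -⟩ := exists_kernel_vector h
  have h1 : γ 1 ≠ 0 := h.ne_zero (by decide) (by decide)
  exact SubStep.eventually_isUnit_stageMatrix_atTop (coeffs_zero γ) (SubStep.isUnit_add_single
    (isLowerTriangular_coeffs γ) (coeffs_zero γ) (coeffs_diag γ) (by positivity)) hw hw0 ξ hk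

theorem hasDoubleEigenvalueAtInfinity_coeffs (h : Admissible γ) (ξ : ℝ) {k : ℝ} (hk : 0 < k) :
    SubStep.HasDoubleEigenvalueAtInfinity (fun ω => SubStep.Dnum (coeffs γ) ξ ω k)
      (rhoInf (γ 1)) := by
  obtain ⟨w, hw, hw0, hw6⟩ := exists_kernel_vector h
  have h1 : γ 1 ≠ 0 := h.ne_zero (by decide) (by decide)
  rw [← hw6]
  exact SubStep.hasDoubleEigenvalueAtInfinity_of_kernel (coeffs_zero γ)
    (SubStep.isUnit_add_single (isLowerTriangular_coeffs γ) (coeffs_zero γ) (coeffs_diag γ)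
      (by positivity)) hw hw0 ξ hk

/-! ### Admissibility of the default ratios and dissipation control. -/

section DefaultRatios

variable {g : ℝ}

theorem defaultRatios_distinct (hg : g ≠ 0) (i j : Fin 7) (hi : i ≠ 6) (hj : j ≠ 6)
    (hij : i ≠ j) : defaultRatios g i ≠ defaultRatios g j := by
  have e : ∀ k : Fin 7, k ≠ 6 → defaultRatios g k = (k : ℕ) * g := by
    intro k hk
    fin_cases k <;> simp [defaultRatios] at hk ⊢
  rw [e i hi, e j hj]
  intro h
  exact hij (Fin.ext (by exact_mod_cast mul_right_cancel₀ hg h))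

theorem a65_defaultRatios (hg : g ≠ 0) : a65 (defaultRatios g) =
    (2 - 30 * g + 165 * g ^ 2 - 410 * g ^ 3 + 444 * g ^ 4 - 144 * g ^ 5) / (1440 * g ^ 5) := by
  have hd : (60 * (5 * g) * (4 * g - 5 * g) * (3 * g - 5 * g) * (2 * g - 5 * g) * (g - 5 * g)) =
      1440 * 5 * g ^ 5 := by ring
  simp only [a65, defaultRatios, Matrix.cons_val]
  rw [hd]
  field_simp
  ring

theorem a64_defaultRatios (hg : g ≠ 0) : a64 (defaultRatios g) =
    (-10 + 162 * g - 945 * g ^ 2 + 2450 * g ^ 3 - 2730 * g ^ 4 + 900 * g ^ 5) /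
      (1440 * g ^ 5) := by
  have hd : (60 * (4 * g) * (3 * g - 4 * g) * (2 * g - 4 * g) * (g - 4 * g)) =
      -(1440 * g ^ 4) := by ring
  rw [a64, a65_defaultRatios hg]
  simp only [defaultRatios, Matrix.cons_val]
  rw [hd]
  field_simp
  ring

/-- The first three polynomials are the numerators of `a65`, `a64` and `a54` at the default ratios;
the fourth is -240 times the right-hand side of `moment_three_two`. -/
theorem defaultRatios_signs (h1 : 1 / 3 ≤ g) (h2 : g ≤ 7 / 20) :
    0 < 2 - 30 * g + 165 * g ^ 2 - 410 * g ^ 3 + 444 * g ^ 4 - 144 * g ^ 5 ∧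
    -10 + 162 * g - 945 * g ^ 2 + 2450 * g ^ 3 - 2730 * g ^ 4 + 900 * g ^ 5 < 0 ∧
    0 < -2 + 30 * g - 160 * g ^ 2 + 370 * g ^ 3 - 345 * g ^ 4 + 90 * g ^ 5 ∧
    -2 + 30 * g - 155 * g ^ 2 + 330 * g ^ 3 - 270 * g ^ 4 + 60 * g ^ 5 < 0 := by
  obtain ⟨t, rfl⟩ : ∃ t, g = 1 / 3 + t := ⟨g - 1 / 3, by ring⟩
  have h0 : 0 ≤ t := by linarith
  have ht : t ≤ 1 / 60 := by linarith
  -- On the short interval 0 ≤ t ≤ 1/60 each power of t is at most 1/60 of the preceding one, so the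
  -- lower-order terms of the shifted polynomials decide the signs.
  have k : ∀ n : ℕ, 0 ≤ t ^ n ∧ t ^ (n + 1) ≤ 1 / 60 * t ^ n := fun n =>
    ⟨by positivity, by rw [pow_succ']; exact mul_le_mul_of_nonneg_right ht (by positivity)⟩
  have k2 := k 2
  have k3 := k 3
  have k4 := k 4
  have k1 := k 1
  norm_num at k1 k2 k3 k4
  refine ⟨?_, ?_, ?_, ?_⟩ <;> nlinarith

theorem admissible_defaultRatios (h1 : 1 / 3 ≤ g) (h2 : g ≤ 7 / 20) :
    Admissible (defaultRatios g) := by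
  have hg : g ≠ 0 := by linarith
  obtain ⟨s65, s64, s54, s43⟩ := defaultRatios_signs h1 h2
  have hd := defaultRatios_distinct hg
  have h65 : a65 (defaultRatios g) ≠ 0 := by
    rw [a65_defaultRatios hg]
    exact div_ne_zero s65.ne' (by positivity)
  have h64 : a64 (defaultRatios g) ≠ 0 := by
    rw [a64_defaultRatios hg]
    exact div_ne_zero s64.ne (by positivity)
  have h54 : a54 (defaultRatios g) ≠ 0 := by
    have hden : 60 * a65 (defaultRatios g) * (4 * g) * (3 * g - 4 * g) * (2 * g - 4 * g) *
        (g - 4 * g) ≠ 0 := by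
      have e : 60 * a65 (defaultRatios g) * (4 * g) * (3 * g - 4 * g) * (2 * g - 4 * g) *
        (g - 4 * g) = -(1440 * a65 (defaultRatios g) * g ^ 4) := by ring
      rw [e]
      exact neg_ne_zero.2 (by positivity)
    rw [a54]
    simp only [defaultRatios, Matrix.cons_val] at hden ⊢
    refine div_ne_zero ?_ hden
    refine ne_of_gt (lt_of_lt_of_eq s54 ?_)
    ring
  refine ⟨rfl, rfl, hd, h65, h64, h54, fun h43 => ?_⟩
  -- No closed form of `a43` is needed: if it vanished, so would the left side of this moment,
  -- contrary to the sign of the right side.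
  have := moment_three_two rfl hd h65 h64 h54
  rw [h43] at this
  simp only [defaultRatios, Matrix.cons_val] at this
  refine s43.ne ?_
  linear_combination 240 * this

theorem exists_rhoInf_eq {ρ : ℝ} (h0 : 0 ≤ ρ) (h1 : ρ ≤ 1) :
    ∃ g ∈ Set.Icc (1 / 3 : ℝ) (7 / 20), rhoInf g = ρ := by
  have hc : ContinuousOn rhoInf (Set.Icc (1 / 3 : ℝ) (7 / 20)) := by
    unfold rhoInf
    refine ContinuousOn.div (by fun_prop) (by fun_prop) fun x hx => ?_
    have : 0 < x := lt_of_lt_of_le (by norm_num) hx.1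
    positivity
  -- The primed version fits because the endpoint values are in reverse order: `rhoInf` is 1 at 1/3
  -- and negative at 7/20.
  have h2 := intermediate_value_Icc' (by norm_num) hc
  obtain ⟨g, hg, h⟩ := h2 ⟨le_trans (by norm_num [rhoInf]) h0, h1.trans (by norm_num [rhoInf])⟩
  exact ⟨g, hg, h⟩

end DefaultRatios

end

end SUCI6

theorem mainTheorem4 :
    (∀ γ : Fin 7 → ℝ, SUCI6.Admissible γ →
      SubStep.HasOrder (SUCI6.coeffs γ) γ 6 ∧
      (∀ ξ ω : ℝ, 0 ≤ ξ → ξ < 1 → 0 < ω →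
        (∀ i j : Fin 2,
          (fun h => SubStep.Dnum (SUCI6.coeffs γ) ξ ω h i j - SubStep.Dexa ξ ω h i j)
            =O[𝓝[>] 0] (fun h : ℝ => h ^ 7)) ∧
        (∀ i : Fin 2,
          (fun h => SubStep.Lnum (SUCI6.coeffs γ) γ ξ ω h i - SubStep.Lexa ξ ω h i)
            =O[𝓝[>] 0] (fun h : ℝ => h ^ 7))) ∧
      (∀ ξ h : ℝ, 0 < h →
        (∀ᶠ ω in atTop, IsUnit (SubStep.stageMatrix (SUCI6.coeffs γ) ξ ω h)) ∧
        SubStep.HasDoubleEigenvalueAtInfinity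
          (fun ω => SubStep.Dnum (SUCI6.coeffs γ) ξ ω h) (SUCI6.rhoInf (γ 1)))) ∧
    (∀ ρ ∈ Set.Icc (0 : ℝ) 1, ∃ g ∈ Set.Ioo (0 : ℝ) 1,
      SUCI6.Admissible (SUCI6.defaultRatios g) ∧
      SUCI6.rhoInf g = ρ ∧
      ∀ ξ h : ℝ, 0 < h → SubStep.HasDoubleEigenvalueAtInfinity
        (fun ω => SubStep.Dnum (SUCI6.coeffs (SUCI6.defaultRatios g)) ξ ω h) ρ) := by
  refine ⟨fun γ h => ?_, fun ρ hρ => ?_⟩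
  · have hord : SubStep.HasOrder (SUCI6.coeffs γ) γ 6 :=
      SubStep.hasOrder_of_linearOrderConditions (SUCI6.linearOrderConditions_coeffs h) h.one
    exact ⟨hord, fun ξ ω h0 h1 hω =>
      ⟨fun i j => SubStep.Dnum_sub_Dexa_isBigO hord h0 h1 hω i j,
        fun i => SubStep.Lnum_sub_Lexa_isBigO hord h0 h1 hω i⟩,
      fun ξ k hk => ⟨SUCI6.eventually_isUnit_stageMatrix_coeffs h ξ hk,
        SUCI6.hasDoubleEigenvalueAtInfinity_coeffs h ξ hk⟩⟩
  · obtain ⟨g, hg, rfl⟩ := SUCI6.exists_rhoInf_eq hρ.1 hρ.2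
    have h := SUCI6.admissible_defaultRatios hg.1 hg.2
    exact ⟨g, ⟨lt_of_lt_of_le (by norm_num) hg.1, lt_of_le_of_lt hg.2 (by norm_num)⟩, h, rfl,
      fun ξ k hk => SUCI6.hasDoubleEigenvalueAtInfinity_coeffs h ξ hk⟩
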